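/- For complex $u$ with $\Re u>0$ let $\Phi(z,s,u)$ be the Lerch transcendent, i.e. the analytic continuation of the series $\sum_{n\ge 0} z^n/(u+n)^s$ (principal branch of the power): for $z\in\mathbb C\setminus[1,\infty)$ and $s\in\mathbb C$ it is the holomorphic continuation in $z$ from $|z|<1$ to $\mathbb C\setminus[1,\infty)$; for $z=1$ and $s\ne 1$ it is the continuation in $s$ of the series (convergent for $\Re s>1$), i.e. the Hurwitz zeta function. Let $m\ge 1$ be an integer and $u,z,s\in\mathbb C$ with $\Re u>0$, and suppose that either $z\in\mathbb C\setminus[1,\infty)$ and $\Re s>-m$, or $z=1$ and $\Re s>1-m$. Then: (a) If $m>1$, $\Re v>0$, $u\neq v$ and $$F_{m,u,v}(x_1,\dots,x_m)=(x_1\cdots x_m)^{v-1}\sum_{k=1}^{m-1}(x_1\cdots x_k)^{u-v},$$ then the following integral converges absolutely and $$\int_{[0,1]^m}\frac{F_{m,u,v}(x_1,\dots,x_m)}{1-z\,x_1\cdots x_m}\,(-\ln (x_1\cdots x_m))^{s}\,dx_1\cdots dx_m=\frac{\Gamma(s+m-1)}{(m-2)!}\cdot\frac{\Phi(z,s+m-1,v)-\Phi(z,s+m-1,u)}{u-v},$$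 where at $s=1-m$ (if $z\ne1$) and at $s=2-m$ (if $z=1$) the right-hand side, which has a removable singularity in $s$ there, stands for its limit. (b) The following integral converges absolutely and $$\int_{[0,1]^m}\frac{(x_1\cdots x_m)^{u-1}}{1-z\,x_1\cdots x_m}\,(-\ln (x_1\cdots x_m))^{s}\,dx_1\cdots dx_m=\frac{\Gamma(s+m)}{(m-1)!}\,\Phi(z,s+m,u).$$ -/

import Mathlib

/-- The plane cut along the real half-line from `1` to infinity: `ℂ ∖ [1,∞)`. -/
def cutPlane : Set ℂ := ((fun r : ℝ => (r : ℂ)) '' Set.Ici 1)ᶜ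

/-- The Lerch series `∑ zⁿ / (u+n)^s` (principal branch of the power). It converges absolutely,
for `Re u > 0`, if `|z| < 1`, or if `|z| = 1` and `Re s > 1`. -/
noncomputable def lerchSeries (z s u : ℂ) : ℂ := ∑' n : ℕ, z ^ n / (u + n) ^ s

/-- `w` is the value at `(z, s, u)` of the analytic continuation of the Lerch series.

* For `z ∈ ℂ ∖ [1,∞)` the series, as a function of `z`, is continued holomorphically from the
  unit disc to the (connected) cut plane.
* For `z = 1` and `s ≠ 1` the series (the Hurwitz zeta function), as a function of `s`, is
  continued holomorphically from `Re s > 1` to a (connected) punctured half-plane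
  `Re t > σ, t ≠ 1` that contains `s`.

In both cases the value is determined by the identity theorem. -/
def IsLerchValue (z s u w : ℂ) : Prop :=
  (z ∈ cutPlane ∧ ∃ f : ℂ → ℂ, DifferentiableOn ℂ f cutPlane ∧
      (∀ y : ℂ, ‖y‖ < 1 → f y = lerchSeries y s u) ∧ f z = w) ∨
  (z = 1 ∧ s ≠ 1 ∧ ∃ σ : ℝ, σ < s.re ∧
    ∃ f : ℂ → ℂ, DifferentiableOn ℂ f {t : ℂ | σ < t.re ∧ t ≠ 1} ∧
      (∀ t : ℂ, 1 < t.re → f t = lerchSeries 1 t u) ∧ f s = w)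

open Classical in
/-- The Lerch transcendent `Φ(z, s, u)`: the analytic continuation of the Lerch series, with
value `0` by convention where there is none (such as `z = 1`, `s = 1`). -/
noncomputable def lerchPhi (z s u : ℂ) : ℂ :=
  if h : ∃ w : ℂ, IsLerchValue z s u w then h.choose else 0

/-- The function `F_{m,u,v}(x₁,…,x_m) = (x₁⋯x_m)^(v-1) ∑_{k=1}^{m-1} (x₁⋯x_k)^(u-v)`.
The variable `x_k` is `x i` with `i = k - 1`, so that `k ≤ m - 1` reads `i + 1 < m`. -/
noncomputable def cubeF (m : ℕ) (u v : ℂ) (x : Fin m → ℝ) : ℂ :=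
  ((∏ i, x i : ℝ) : ℂ) ^ (v - 1) *
    ∑ k ∈ Finset.univ.filter (fun k : Fin m => (k : ℕ) + 1 < m),
      ((∏ i ∈ Finset.Iic k, x i : ℝ) : ℂ) ^ (u - v)

/-- The integrand `N(x) (-ln (x₁⋯x_m))^s / (1 - z x₁⋯x_m)` with numerator `N`. -/
noncomputable def cubeIntegrand (m : ℕ) (z s : ℂ) (N : (Fin m → ℝ) → ℂ) (x : Fin m → ℝ) : ℂ :=
  N x / (1 - z * ((∏ i, x i : ℝ) : ℂ)) * ((-Real.log (∏ i, x i) : ℝ) : ℂ) ^ s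

open MeasureTheory Set
open scoped ENNReal

/-! Under `x = exp (-t)` a uniform variable becomes a standard exponential one, so `-ln (x₁⋯x_m)`
has the Erlang density `y^(m-1) e^{-y} / (m-1)!`. Integral (b) is therefore a one-dimensional Mellin
integral of `e^{-uy} / (1 - z e^{-y})`, namely `lerchIntegral` at `s + m`.

For (a), the pair (sum of the first `k` exponentials, total sum) has density `q^(k-1)/(k-1)! ·
(y-q)^(m-k-1)/(m-k-1)! · e^{-y}` on `0 < q < y`. Summed over `k` this collapses, by the binomial
theorem, to `y^(m-2) e^{-y} / (m-2)!`, with no dependence on `q` (`sum_jointPDF_toReal`).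
Integrating `e^{-(u-v)q}` over `0 < q < y` then produces `(e^{-vy} - e^{-uy})/(u-v)` and hence
`lerchDiffIntegral` at `s + m - 1`.

It remains to identify the Mellin integrals with `Γ` times Lerch values. For `|z| < 1` the kernel is
expanded geometrically and integrated termwise. Both integrals are holomorphic in `z` on the cut
plane, which gives the continuation in `z`. The difference of exponentials gains a factor `y` at the
origin, so `lerchDiffIntegral` converges one unit further left than `lerchIntegral`. There a shift
recurrence in `u` shows that the continuation of a single Lerch series exists
(`exists_lerch_continuation`). At `z = 1` the continuation in `s` is the Riemann zeta function, the
case `u = 1`, corrected by a difference integral (`isLerchValue_one`). The removable singularities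
are handled by continuity of `lerchDiffIntegral` in the exponent. -/

/-! ### Uniform variables and the exponential law -/

/-- The uniform distribution on the unit interval. -/
noncomputable def unitUniform : Measure ℝ := volume.restrict (Icc 0 1)

/-- The uniform distribution on the unit cube indexed by `ι`. -/
noncomputable def cubeUniform (ι : Type*) [Fintype ι] : Measure (ι → ℝ) :=
  Measure.pi fun _ => unitUniform

/-- The function `x ↦ -log x₁ - ⋯ - log xₘ`. -/
noncomputable def negLogSum {ι : Type*} [Fintype ι] (x : ι → ℝ) : ℝ := ∑ i, -Real.log (x i)

/-- The density `yⁿ e^{-y} / n!` on `(0, ∞)`. -/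
noncomputable def erlangPDF (n : ℕ) (y : ℝ) : ℝ≥0∞ :=
  (Ioi (0 : ℝ)).indicator (fun y => ENNReal.ofReal (y ^ n / n.factorial * Real.exp (-y))) y

/-- The Erlang distribution of `n + 1` independent standard exponential variables. -/
noncomputable def erlangMeasure (n : ℕ) : Measure ℝ := volume.withDensity (erlangPDF n)

instance : SigmaFinite unitUniform := by unfold unitUniform; infer_instance

instance (ι : Type*) [Fintype ι] : SigmaFinite (cubeUniform ι) := by
  unfold cubeUniform; infer_instance

lemma volume_restrict_Icc_cube (ι : Type*) [Fintype ι] :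
    (volume : Measure (ι → ℝ)).restrict (Icc 0 1) = cubeUniform ι := by
  rw [volume_pi, ← pi_univ_Icc, Measure.restrict_pi_pi]
  rfl

lemma measurable_negLogSum {ι : Type*} [Fintype ι] :
    Measurable (negLogSum : (ι → ℝ) → ℝ) := by
  unfold negLogSum
  fun_prop

lemma measurable_erlangPDF (n : ℕ) : Measurable (erlangPDF n) := by
  unfold erlangPDF
  exact Measurable.indicator (by fun_prop) measurableSet_Ioi

instance (n : ℕ) : SFinite (erlangMeasure n) := by unfold erlangMeasure; infer_instance

/-- Change of variables `x = e^{-y}` from `(0, ∞)` onto `(0, 1)`; the Jacobian `e^{-y}` is the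
density. -/
lemma map_neg_log_unitUniform :
    unitUniform.map (fun x => -Real.log x) = erlangMeasure 0 := by
  have hm : Measurable fun x : ℝ => -Real.log x := by fun_prop
  refine Measure.ext_of_lintegral _ fun f hf => ?_
  rw [lintegral_map hf hm, erlangMeasure, lintegral_withDensity_eq_lintegral_mul _
    (measurable_erlangPDF 0) hf, unitUniform]
  have himg : (fun y : ℝ => Real.exp (-y)) '' Ioi 0 = Ioo 0 1 := by
    ext x
    constructor
    · rintro ⟨y, hy, rfl⟩
      exact ⟨Real.exp_pos _, by simpa using hy⟩
    · rintro ⟨h0, h1⟩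
      exact ⟨-Real.log x, by simpa using Real.log_neg h0 h1, by simp [Real.exp_log h0]⟩
  rw [← restrict_Ioo_eq_restrict_Icc, ← himg,
    lintegral_image_eq_lintegral_abs_deriv_mul (f' := fun y => -Real.exp (-y)) measurableSet_Ioi,
    ← lintegral_indicator measurableSet_Ioi]
  · refine lintegral_congr fun y => ?_
    by_cases hy : y ∈ Ioi (0 : ℝ) <;> simp [erlangPDF, hy]
  · intro y _
    simpa using ((hasDerivAt_neg y).exp).hasDerivWithinAt
  · intro a _ b _ h
    simpa using h

/-! ### Laws of partial sums of exponential variables -/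

/-- The joint density of the first `k + 1` and of all `k + l + 2` exponential variables. -/
noncomputable def jointPDF (k l : ℕ) (p : ℝ × ℝ) : ℝ≥0∞ :=
  erlangPDF k p.1 * erlangPDF l (p.2 - p.1)

lemma measurable_jointPDF (k l : ℕ) : Measurable (jointPDF k l) := by
  unfold jointPDF
  exact ((measurable_erlangPDF k).comp measurable_fst).mul
    ((measurable_erlangPDF l).comp (by fun_prop))

/-- The shear `(p, q) ↦ (p, p + q)` preserves Lebesgue measure, so the product density is merely
rewritten in the new coordinates. -/
lemma map_erlangMeasure_prod (k l : ℕ) :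
    ((erlangMeasure k).prod (erlangMeasure l)).map (fun p => (p.1, p.1 + p.2)) =
      (volume.prod volume).withDensity (jointPDF k l) := by
  have hm : Measurable fun p : ℝ × ℝ => (p.1, p.1 + p.2) := by fun_prop
  refine Measure.ext_of_lintegral _ fun f hf => ?_
  have hd : Measurable fun p : ℝ × ℝ => erlangPDF k p.1 * erlangPDF l p.2 :=
    ((measurable_erlangPDF k).comp measurable_fst).mul
      ((measurable_erlangPDF l).comp measurable_snd)
  have hf' : Measurable fun p : ℝ × ℝ => f (p.1, p.1 + p.2) := hf.comp hm
  rw [lintegral_map hf hm, erlangMeasure, erlangMeasure,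
    prod_withDensity (measurable_erlangPDF k) (measurable_erlangPDF l),
    lintegral_withDensity_eq_lintegral_mul _ hd hf',
    lintegral_withDensity_eq_lintegral_mul _ (measurable_jointPDF k l) hf,
    ← (measurePreserving_prod_add (volume : Measure ℝ) (volume : Measure ℝ)).lintegral_comp
      ((measurable_jointPDF k l).mul hf)]
  simp [jointPDF]

lemma jointPDF_eq (k l : ℕ) (q y : ℝ) :
    jointPDF k l (q, y) = (Ioo 0 y).indicator (fun q => ENNReal.ofReal
      (q ^ k / k.factorial * ((y - q) ^ l / l.factorial) * Real.exp (-y))) q := by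
  unfold jointPDF erlangPDF
  by_cases h0 : 0 < q <;> by_cases h1 : q < y
  · have : 0 ≤ q ^ k / k.factorial * Real.exp (-q) := by positivity
    simp only [h0, h1, indicator, mem_Ioi, mem_Ioo, sub_pos, and_self, if_true,
      ← ENNReal.ofReal_mul this]
    congr 1
    rw [show -y = -q + -(y - q) by ring, Real.exp_add]
    ring
  all_goals simp [h0, h1, indicator]

/-- Convolution with one more exponential variable: this drives the induction in
`map_negLogSum_fin`. -/
lemma lintegral_jointPDF_zero (n : ℕ) (y : ℝ) :
    ∫⁻ q, jointPDF 0 n (q, y) = erlangPDF (n + 1) y := by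
  simp only [jointPDF_eq]
  rw [lintegral_indicator measurableSet_Ioo]
  by_cases hy : 0 < y
  · rw [← ofReal_integral_eq_lintegral_ofReal, ← integral_Ioc_eq_integral_Ioo,
      ← intervalIntegral.integral_of_le hy.le]
    · simp only [erlangPDF, indicator, mem_Ioi, hy, if_true]
      congr 1
      have : ∫ q in (0 : ℝ)..y, (y - q) ^ n = y ^ (n + 1) / (n + 1) := by
        rw [intervalIntegral.integral_comp_sub_left (fun q => q ^ n) y]
        simp
      simp only [pow_zero, Nat.factorial_zero, Nat.cast_one, div_one, one_mul,
        intervalIntegral.integral_mul_const, intervalIntegral.integral_div, this,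
        Nat.factorial_succ]
      push_cast
      field_simp
    · refine (Continuous.integrableOn_Icc (a := 0) (b := y) (by fun_prop)).mono_set Ioo_subset_Icc_self
    · refine (ae_restrict_iff' measurableSet_Ioo).2 (.of_forall fun q hq => ?_)
      have := sub_pos.2 hq.2
      have := hq.1
      positivity
  · simp [erlangPDF, hy]

lemma map_negLogSum_fin (n : ℕ) :
    (cubeUniform (Fin (n + 1))).map negLogSum = erlangMeasure n := by
  induction n with
  | zero =>
    have h := (measurePreserving_funUnique unitUniform (Fin 1)).map_eq
    rw [← map_neg_log_unitUniform, ← h, Measure.map_map (by fun_prop) (by fun_prop)]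
    congr 1
    ext x
    simp [negLogSum]
  | succ n ih =>
    have h := (measurePreserving_piFinSuccAbove (fun _ : Fin (n + 2) => unitUniform) 0)
    have e : (negLogSum : (Fin (n + 2) → ℝ) → ℝ) =
        Prod.snd ∘ (fun p : ℝ × ℝ => (p.1, p.1 + p.2)) ∘
          (Prod.map (fun x => -Real.log x) negLogSum) ∘
          (MeasurableEquiv.piFinSuccAbove (fun _ : Fin (n + 2) => ℝ) 0) := by
      ext x
      simp [negLogSum, Fin.sum_univ_succ (n := n + 1), Fin.tail]
    have hm : Measurable fun p : ℝ × ℝ => (p.1, p.1 + p.2) := by fun_prop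
    have hl : Measurable fun x : ℝ => -Real.log x := by fun_prop
    have hp : Measurable (Prod.map (fun x => -Real.log x) (negLogSum : (Fin (n + 1) → ℝ) → ℝ)) :=
      hl.prodMap measurable_negLogSum
    rw [e, ← Measure.map_map measurable_snd (by exact hm.comp (hp.comp (MeasurableEquiv.measurable _))),
      ← Measure.map_map hm (by exact hp.comp (MeasurableEquiv.measurable _)),
      ← Measure.map_map hp (MeasurableEquiv.measurable _), cubeUniform, h.map_eq]
    change ((((unitUniform.prod (cubeUniform (Fin (n + 1)))).map _).map _).map _) = _
    rw [← Measure.map_prod_map _ _ hl measurable_negLogSum, ih, map_neg_log_unitUniform,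
      map_erlangMeasure_prod]
    refine Measure.ext_of_lintegral _ fun f hf => ?_
    have hf' : Measurable fun p : ℝ × ℝ => f p.2 := hf.comp measurable_snd
    rw [lintegral_map hf measurable_snd, lintegral_withDensity_eq_lintegral_mul _
      (measurable_jointPDF 0 n) hf', erlangMeasure,
      lintegral_withDensity_eq_lintegral_mul _ (measurable_erlangPDF _) hf,
      lintegral_prod_symm' _ ((measurable_jointPDF 0 n).mul hf')]
    refine lintegral_congr fun y => ?_
    simp only [Pi.mul_apply, ← lintegral_jointPDF_zero]
    rw [lintegral_mul_const]
    exact (measurable_jointPDF 0 n).comp (by fun_prop)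

/-- Arbitrary index types are needed because `map_negLogSum_pair` splits the coordinates into two
subtypes. -/
lemma map_negLogSum {ι : Type*} [Fintype ι] {n : ℕ} (hn : Fintype.card ι = n + 1) :
    (cubeUniform ι).map negLogSum = erlangMeasure n := by
  have e : Fin (n + 1) ≃ ι := (Fintype.equivFinOfCardEq hn).symm
  have h := measurePreserving_piCongrLeft (fun _ : ι => unitUniform) e
  rw [cubeUniform, ← h.map_eq, Measure.map_map measurable_negLogSum (MeasurableEquiv.measurable _),
    ← map_negLogSum_fin]
  congr 1
  ext x
  simp only [negLogSum, Function.comp_apply]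
  rw [← e.sum_comp]
  refine Finset.sum_congr rfl fun i _ => ?_
  congr 2
  exact MeasurableEquiv.piCongrLeft_apply_apply (β := fun _ => ℝ) e x i

/-- The coordinates up to `k` and those beyond it are independent blocks of sizes `k + 1` and `l +
1`, so their sums are independent Erlang variables. -/
lemma map_negLogSum_pair {m : ℕ} (k : Fin m) {l : ℕ} (hl : (k : ℕ) + l + 2 = m) :
    (cubeUniform (Fin m)).map (fun x => (∑ i ∈ Finset.Iic k, -Real.log (x i), negLogSum x)) =
      (volume.prod volume).withDensity (jointPDF k l) := by
  classical
  have h := measurePreserving_piEquivPiSubtypeProd (fun _ : Fin m => unitUniform) (· ≤ k)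
  have e : (fun x : Fin m → ℝ => (∑ i ∈ Finset.Iic k, -Real.log (x i), negLogSum x)) =
      (fun p : ℝ × ℝ => (p.1, p.1 + p.2)) ∘ (Prod.map negLogSum negLogSum) ∘
        (MeasurableEquiv.piEquivPiSubtypeProd (fun _ : Fin m => ℝ) (· ≤ k)) := by
    ext x
    · simp only [negLogSum, Function.comp_apply, Prod.map, MeasurableEquiv.piEquivPiSubtypeProd]
      exact (Finset.sum_subtype (Finset.Iic k) (by simp) fun i => -Real.log (x i))
    · simp only [negLogSum, Function.comp_apply, Prod.map, MeasurableEquiv.piEquivPiSubtypeProd]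
      exact (Fintype.sum_subtype_add_sum_subtype (· ≤ k) fun i => -Real.log (x i)).symm
  have hm : Measurable fun p : ℝ × ℝ => (p.1, p.1 + p.2) := by fun_prop
  have hp : Measurable (Prod.map (negLogSum : ({i : Fin m // i ≤ k} → ℝ) → ℝ)
      (negLogSum : ({i : Fin m // ¬ i ≤ k} → ℝ) → ℝ)) :=
    measurable_negLogSum.prodMap measurable_negLogSum
  have c1 : Fintype.card {i : Fin m // i ≤ k} = k + 1 := by
    rw [Fintype.card_subtype]
    rw [← Fin.card_Iic k]
    congr 1
    ext i
    simp
  have c2 : Fintype.card {i : Fin m // ¬ i ≤ k} = l + 1 := by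
    rw [Fintype.card_subtype_compl, c1, Fintype.card_fin]
    omega
  rw [e, ← Measure.map_map hm (by exact hp.comp (MeasurableEquiv.measurable _)),
    ← Measure.map_map hp (MeasurableEquiv.measurable _), cubeUniform, h.map_eq,
    ← map_erlangMeasure_prod, ← map_negLogSum c1, ← map_negLogSum c2,
    Measure.map_prod_map _ _ measurable_negLogSum measurable_negLogSum]
  rfl

/-! ### Cube integrals as integrals over the half-line and the wedge -/

lemma erlangPDF_lt_top (n : ℕ) (y : ℝ) : erlangPDF n y < ∞ := by
  unfold erlangPDF
  by_cases hy : y ∈ Ioi (0 : ℝ) <;> simp [hy]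

lemma toReal_erlangPDF_smul (n : ℕ) (A : ℝ → ℂ) :
    (fun y => (erlangPDF n y).toReal • A y) = (Ioi (0 : ℝ)).indicator
      (fun y => ((y ^ n / n.factorial * Real.exp (-y) : ℝ) : ℂ) * A y) := by
  ext y
  by_cases hy : 0 < y
  · have : 0 ≤ y ^ n / n.factorial * Real.exp (-y) := by positivity
    simp [erlangPDF, indicator, hy, ENNReal.toReal_ofReal this]
  · simp [erlangPDF, indicator, hy]

/-- The integral over the cube of a function of `x₁ ⋯ xₘ`. -/
lemma integral_cube_comp_negLogSum {m n : ℕ} (hm : m = n + 1) {A : ℝ → ℂ} (hA : Measurable A)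
    (hi : IntegrableOn (fun y => ((y ^ n / n.factorial * Real.exp (-y) : ℝ) : ℂ) * A y) (Ioi 0)) :
    Integrable (fun x => A (negLogSum x)) (cubeUniform (Fin m)) ∧
      ∫ x, A (negLogSum x) ∂cubeUniform (Fin m) =
        ∫ y in Ioi 0, ((y ^ n / n.factorial * Real.exp (-y) : ℝ) : ℂ) * A y := by
  have hmap := map_negLogSum (ι := Fin m) (n := n) (by simp [hm])
  have hint : Integrable A (erlangMeasure n) := by
    rw [erlangMeasure, integrable_withDensity_iff_integrable_smul' (measurable_erlangPDF n)
      (.of_forall (erlangPDF_lt_top n)), toReal_erlangPDF_smul,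
      integrable_indicator_iff measurableSet_Ioi]
    exact hi
  constructor
  · rw [← hmap] at hint
    exact hint.comp_measurable measurable_negLogSum
  · rw [← integral_map (φ := negLogSum) (f := A) measurable_negLogSum.aemeasurable
        hA.aestronglyMeasurable, hmap, erlangMeasure,
      integral_withDensity_eq_integral_toReal_smul (measurable_erlangPDF n)
      (.of_forall (erlangPDF_lt_top n)), toReal_erlangPDF_smul, integral_indicator measurableSet_Ioi]

lemma jointPDF_lt_top (k l : ℕ) (p : ℝ × ℝ) : jointPDF k l p < ∞ :=
  ENNReal.mul_lt_top (erlangPDF_lt_top _ _) (erlangPDF_lt_top _ _)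

/-- The region `0 < q < y`. -/
def wedge : Set (ℝ × ℝ) := {p | 0 < p.1 ∧ p.1 < p.2}

lemma measurableSet_wedge : MeasurableSet wedge :=
  (measurableSet_lt measurable_const measurable_fst).inter
    (measurableSet_lt measurable_fst measurable_snd)

/-- Binomial theorem for `(q + (y - q))^n`, with `1/(k! (n-k)!)` supplying the binomial coefficients
up to `n!`. -/
lemma sum_jointPDF_toReal (n : ℕ) (p : ℝ × ℝ) :
    ∑ k ∈ Finset.univ.filter (fun k : Fin (n + 2) => (k : ℕ) + 1 < n + 2),
        (jointPDF k (n - k) p).toReal =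
      wedge.indicator (fun p => p.2 ^ n / n.factorial * Real.exp (-p.2)) p := by
  obtain ⟨q, y⟩ := p
  -- The filter discards exactly the last index `n + 1`, leaving the `n + 1` terms of the binomial
  -- expansion.
  rw [Finset.sum_filter, Fin.sum_univ_castSucc]
  simp only [Fin.val_castSucc, Fin.val_last, lt_irrefl, if_false, add_zero]
  rw [Finset.sum_congr rfl fun (k : Fin (n + 1)) _ =>
      if_pos (show (k : ℕ) + 1 < n + 2 by omega),
    ← Finset.sum_range (fun k => (jointPDF k (n - k) (q, y)).toReal)]
  simp only [jointPDF_eq]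
  by_cases h : 0 < q ∧ q < y
  · have hq : q ∈ Ioo 0 y := h
    have hw : (q, y) ∈ wedge := h
    have h1 := sub_pos.2 h.2
    have h0 := h.1
    simp only [indicator_of_mem hq, indicator_of_mem hw]
    rw [Finset.sum_congr rfl fun k _ => ENNReal.toReal_ofReal (by positivity), ← Finset.sum_mul]
    congr 1
    rw [show y ^ n = (q + (y - q)) ^ n by ring, add_pow, Finset.sum_div]
    refine Finset.sum_congr rfl fun k hk => ?_
    have hk : k ≤ n := by simpa [Nat.lt_succ_iff] using hk
    rw [Nat.cast_choose ℝ hk]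
    have := Nat.factorial_ne_zero n
    have := Nat.factorial_ne_zero k
    have := Nat.factorial_ne_zero (n - k)
    field_simp
  · have hq : q ∉ Ioo 0 y := h
    have hw : (q, y) ∉ wedge := h
    simp [indicator_of_notMem hq, indicator_of_notMem hw]

/-- The sum over `k` of the integrals over the cube of a function of `x₁ ⋯ xₖ` and `x₁ ⋯ xₘ`. -/
lemma integral_cube_sum_comp {m n : ℕ} (hm : m = n + 2) {H : ℝ × ℝ → ℂ} (hH : Measurable H)
    (hi : IntegrableOn (fun p => ((p.2 ^ n / n.factorial * Real.exp (-p.2) : ℝ) : ℂ) * H p) wedge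
      (volume.prod volume)) :
    Integrable (fun x => ∑ k ∈ Finset.univ.filter (fun k : Fin m => (k : ℕ) + 1 < m),
        H (∑ i ∈ Finset.Iic k, -Real.log (x i), negLogSum x)) (cubeUniform (Fin m)) ∧
      ∫ x, ∑ k ∈ Finset.univ.filter (fun k : Fin m => (k : ℕ) + 1 < m),
          H (∑ i ∈ Finset.Iic k, -Real.log (x i), negLogSum x) ∂cubeUniform (Fin m) =
        ∫ p in wedge, ((p.2 ^ n / n.factorial * Real.exp (-p.2) : ℝ) : ℂ) * H p
          ∂(volume.prod volume) := by
  subst hm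
  set K := Finset.univ.filter (fun k : Fin (n + 2) => (k : ℕ) + 1 < n + 2) with hK
  have hl : ∀ k ∈ K, (k : ℕ) + (n - k) + 2 = n + 2 := by
    intro k hk
    have : (k : ℕ) + 1 < n + 2 := by simpa [hK] using hk
    omega
  have hsum (p : ℝ × ℝ) : ∑ k ∈ K, (jointPDF k (n - k) p).toReal • H p = wedge.indicator
      (fun p => ((p.2 ^ n / n.factorial * Real.exp (-p.2) : ℝ) : ℂ) * H p) p := by
    rw [← Finset.sum_smul, hK, sum_jointPDF_toReal]
    by_cases hp : p ∈ wedge <;> simp [hp]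
  have hi' : Integrable (fun p => ∑ k ∈ K, (jointPDF k (n - k) p).toReal • H p)
      (volume.prod volume) := by
    simp only [hsum]
    exact (integrable_indicator_iff measurableSet_wedge).2 hi
  -- Only the total is assumed integrable; the weights are nonnegative and multiply the same `H`, so
  -- each summand is dominated by the total.
  have hk (k) (hk : k ∈ K) : Integrable (fun p => (jointPDF k (n - k) p).toReal • H p)
      (volume.prod volume) := by
    refine hi'.mono (((measurable_jointPDF _ _).ennreal_toReal.smul hH).aestronglyMeasurable)
      (.of_forall fun p => ?_)
    rw [← Finset.sum_smul, norm_smul, norm_smul, Real.norm_of_nonneg ENNReal.toReal_nonneg,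
      Real.norm_of_nonneg (Finset.sum_nonneg fun _ _ => ENNReal.toReal_nonneg)]
    gcongr
    exact Finset.single_le_sum (f := fun k : Fin (n + 2) => (jointPDF k (n - k) p).toReal)
      (fun _ _ => ENNReal.toReal_nonneg) hk
  have hmeas (k : Fin (n + 2)) : Measurable fun x : Fin (n + 2) → ℝ =>
      (∑ i ∈ Finset.Iic k, -Real.log (x i), negLogSum x) :=
    Measurable.prodMk (by fun_prop) measurable_negLogSum
  have hk' (k) (hkK : k ∈ K) : Integrable
      (fun x => H (∑ i ∈ Finset.Iic k, -Real.log (x i), negLogSum x)) (cubeUniform (Fin (n + 2))) := by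
    refine Integrable.comp_measurable (g := H) ?_ (hmeas k)
    rw [map_negLogSum_pair k (hl k hkK), integrable_withDensity_iff_integrable_smul'
      (measurable_jointPDF _ _) (.of_forall (jointPDF_lt_top _ _))]
    exact hk k hkK
  refine ⟨integrable_finsetSum _ hk', ?_⟩
  rw [integral_finsetSum _ hk', ← integral_indicator measurableSet_wedge]
  simp only [← hsum]
  rw [integral_finsetSum _ hk]
  refine Finset.sum_congr rfl fun k hkK => ?_
  rw [← integral_map (φ := fun x : Fin (n + 2) → ℝ =>
      (∑ i ∈ Finset.Iic k, -Real.log (x i), negLogSum x)) (f := H) (hmeas k).aemeasurable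
    hH.aestronglyMeasurable, map_negLogSum_pair k (hl k hkK),
    integral_withDensity_eq_integral_toReal_smul (measurable_jointPDF _ _)
      (.of_forall (jointPDF_lt_top _ _))]

/-- Integrating out the first variable over the wedge `0 < q < y`. -/
lemma integral_wedge_mul_exp {B : ℝ → ℂ} (hB : Measurable B) {c : ℂ} {b : ℝ → ℝ}
    (hb : IntegrableOn (fun y => y * b y) (Ioi 0))
    (hbound : ∀ q y : ℝ, 0 < q → q < y → ‖B y * Complex.exp (-c * q)‖ ≤ b y) :
    IntegrableOn (fun p : ℝ × ℝ => B p.2 * Complex.exp (-c * p.1)) wedge (volume.prod volume) ∧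
      ∫ p in wedge, B p.2 * Complex.exp (-c * (p.1 : ℝ)) ∂(volume.prod volume) =
        ∫ y in Ioi (0 : ℝ), B y * ∫ q in (0 : ℝ)..y, Complex.exp (-c * q) := by
  have hm : Measurable fun p : ℝ × ℝ => B p.2 * Complex.exp (-c * p.1) := by fun_prop
  have hsl (y : ℝ) : (fun q => wedge.indicator
      (fun p : ℝ × ℝ => B p.2 * Complex.exp (-c * p.1)) (q, y)) =
      (Ioo 0 y).indicator (fun q : ℝ => B y * Complex.exp (-c * q)) := by
    ext q
    by_cases h : 0 < q ∧ q < y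
    · rw [indicator_of_mem (show (q, y) ∈ wedge from h), indicator_of_mem (show q ∈ Ioo 0 y from h)]
    · rw [indicator_of_notMem (show (q, y) ∉ wedge from h),
        indicator_of_notMem (show q ∉ Ioo 0 y from h)]
  have hc (y : ℝ) : IntegrableOn (fun q : ℝ => B y * Complex.exp (-c * q)) (Ioo 0 y) :=
    (Continuous.integrableOn_Icc (by fun_prop)).mono_set Ioo_subset_Icc_self
  have hint : Integrable (wedge.indicator
      (fun p : ℝ × ℝ => B p.2 * Complex.exp (-c * p.1))) (volume.prod volume) := by
    rw [integrable_prod_iff' (hm.indicator measurableSet_wedge).aestronglyMeasurable]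
    constructor
    · refine .of_forall fun y => ?_
      rw [hsl]
      exact (integrable_indicator_iff measurableSet_Ioo).2 (hc y)
    -- The slice at height `y` has length `y`, whence the majorant `y * b y`.
    · refine ((integrable_indicator_iff measurableSet_Ioi).2 hb).mono' ?_ (.of_forall fun y => ?_)
      · exact ((hm.indicator measurableSet_wedge).norm.aestronglyMeasurable
          (μ := volume.prod volume)).prod_swap.integral_prod_right'
      · have e : (fun q => ‖wedge.indicator
            (fun p : ℝ × ℝ => B p.2 * Complex.exp (-c * p.1)) (q, y)‖) =
            (Ioo 0 y).indicator (fun q : ℝ => ‖B y * Complex.exp (-c * q)‖) := by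
          ext q
          rw [congrFun (hsl y) q, norm_indicator_eq_indicator_norm]
        rw [e, integral_indicator measurableSet_Ioo, Real.norm_of_nonneg (by positivity)]
        by_cases hy : 0 < y
        · rw [indicator_of_mem (show y ∈ Ioi (0 : ℝ) from hy)]
          calc ∫ q in Ioo 0 y, ‖B y * Complex.exp (-c * q)‖
              ≤ ∫ q in Ioo 0 y, b y :=
                setIntegral_mono_on (hc y).norm (by simp) measurableSet_Ioo
                  fun q hq => hbound q y hq.1 hq.2
            _ = y * b y := by simp [hy.le]
        · rw [indicator_of_notMem (show y ∉ Ioi (0 : ℝ) from hy), Ioo_eq_empty hy]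
          simp
  refine ⟨(integrable_indicator_iff measurableSet_wedge).1 hint, ?_⟩
  rw [← integral_indicator measurableSet_wedge, integral_prod_symm _ hint,
    ← integral_indicator measurableSet_Ioi]
  refine integral_congr_ae (.of_forall fun y => ?_)
  simp only [hsl, integral_indicator measurableSet_Ioo]
  by_cases hy : 0 < y
  · rw [indicator_of_mem (show y ∈ Ioi (0 : ℝ) from hy), intervalIntegral.integral_of_le hy.le,
      integral_Ioc_eq_integral_Ioo, integral_const_mul]
  · rw [indicator_of_notMem (show y ∉ Ioi (0 : ℝ) from hy), Ioo_eq_empty hy]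
    simp

/-! ### Gamma integrals with complex scale -/

lemma ne_zero_of_re_pos {a : ℂ} (ha : 0 < a.re) : a ≠ 0 := fun h => by simp [h] at ha

lemma norm_cpow_mul_exp {w a : ℂ} {x : ℝ} (hx : 0 < x) :
    ‖(x : ℂ) ^ w * Complex.exp (-a * x)‖ = x ^ w.re * Real.exp (-(a.re * x)) := by
  rw [norm_mul, Complex.norm_cpow_eq_rpow_re_of_pos hx, Complex.norm_exp]
  simp

lemma integrableOn_rpow_mul_exp {r δ : ℝ} (hr : -1 < r) (hδ : 0 < δ) :
    IntegrableOn (fun x => x ^ r * Real.exp (-(δ * x))) (Ioi 0) := by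
  simpa using integrableOn_rpow_mul_exp_neg_mul_rpow hr one_pos hδ

lemma measurable_cpow_mul_exp (w a : ℂ) :
    Measurable fun x : ℝ => (x : ℂ) ^ w * Complex.exp (-a * x) := by fun_prop

lemma integrableOn_cpow_mul_exp {w a : ℂ} (hw : -1 < w.re) (ha : 0 < a.re) :
    IntegrableOn (fun x : ℝ => (x : ℂ) ^ w * Complex.exp (-a * x)) (Ioi 0) := by
  refine (integrableOn_rpow_mul_exp hw ha).mono'
    (measurable_cpow_mul_exp w a).aestronglyMeasurable ?_
  exact (ae_restrict_iff' measurableSet_Ioi).2 (.of_forall fun x hx => (norm_cpow_mul_exp hx).le)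

lemma isOpen_re_pos : IsOpen {a : ℂ | 0 < a.re} :=
  isOpen_lt continuous_const Complex.continuous_re

/-- Differentiation under the integral: on `Re a > Re a₀ / 2` the derivative is dominated by `x^(Re
w) e^{-(Re a₀ / 2) x}`. -/
lemma differentiableOn_laplace_cpow {w : ℂ} (hw : 0 < w.re) :
    DifferentiableOn ℂ (fun a : ℂ => ∫ x in Ioi (0 : ℝ), (x : ℂ) ^ (w - 1) * Complex.exp (-a * x))
      {a | 0 < a.re} := by
  intro a₀ ha₀
  have ha₀ : 0 < a₀.re := ha₀
  refine DifferentiableAt.differentiableWithinAt ?_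
  have hw' : -1 < (w - 1).re := by simpa using hw
  have hs : {a : ℂ | a₀.re / 2 < a.re} ∈ nhds a₀ :=
    (isOpen_lt continuous_const Complex.continuous_re).mem_nhds (by simpa using half_lt_self ha₀)
  refine (hasDerivAt_integral_of_dominated_loc_of_deriv_le (𝕜 := ℂ)
    (F' := fun a x => (x : ℂ) ^ (w - 1) * (Complex.exp (-a * x) * -x))
    (bound := fun x => x ^ w.re * Real.exp (-(a₀.re / 2 * x))) hs
    (.of_forall fun a => (measurable_cpow_mul_exp _ a).aestronglyMeasurable)
    (integrableOn_cpow_mul_exp hw' ha₀) (by fun_prop) ?_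
    (integrableOn_rpow_mul_exp (by linarith) (half_pos ha₀)) ?_).2.differentiableAt
  · refine (ae_restrict_iff' measurableSet_Ioi).2 (.of_forall fun x hx a ha => ?_)
    have hx : 0 < x := hx
    rw [← mul_assoc, norm_mul, norm_cpow_mul_exp hx, norm_neg, Complex.norm_of_nonneg hx.le]
    have : x ^ w.re = x ^ (w - 1).re * x := by
      rw [← Real.rpow_add_one hx.ne']; simp
    rw [this]
    have ha : a₀.re / 2 < a.re := ha
    have := mul_le_mul_of_nonneg_right ha.le hx.le
    have := Real.exp_le_exp.2 (neg_le_neg this)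
    have := mul_le_mul_of_nonneg_left this (show 0 ≤ x ^ (w - 1).re * x by positivity)
    linarith
  · refine .of_forall fun x a _ => ?_
    have : HasDerivAt (fun a : ℂ => -a * x) (-x : ℂ) a := by
      simpa using (hasDerivAt_neg a).mul_const (x : ℂ)
    exact this.cexp.const_mul _

/-- The Gamma integral with a complex scale. -/
lemma integral_cpow_mul_exp {w a : ℂ} (hw : 0 < w.re) (ha : 0 < a.re) :
    ∫ x in Ioi (0 : ℝ), (x : ℂ) ^ (w - 1) * Complex.exp (-a * x) =
      Complex.Gamma w / a ^ w := by
  have h1 := (differentiableOn_laplace_cpow hw).analyticOnNhd isOpen_re_pos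
  have h2 : AnalyticOnNhd ℂ (fun a : ℂ => Complex.Gamma w / a ^ w) {a | 0 < a.re} := by
    refine DifferentiableOn.analyticOnNhd (fun a ha => ?_) isOpen_re_pos
    have ha : 0 < a.re := ha
    refine DifferentiableAt.differentiableWithinAt ((differentiableAt_const _).div
      (differentiableAt_id.cpow_const (.inl ha)) ?_)
    simp [Complex.cpow_eq_zero_iff, ne_zero_of_re_pos ha]
  -- Both sides are holomorphic on the right half-plane and agree at real scales near `1`, so the
  -- identity theorem applies.
  refine h1.eqOn_of_preconnected_of_frequently_eq h2
    (convex_halfSpace_re_gt 0).isPreconnected (z₀ := 1) (by simp) ?_ ha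
  have ht : Filter.Tendsto (fun r : ℝ => (r : ℂ)) (nhdsWithin 1 {1}ᶜ) (nhdsWithin 1 {1}ᶜ) := by
    refine tendsto_nhdsWithin_iff.2 ⟨?_, ?_⟩
    · exact (Complex.continuous_ofReal.tendsto' 1 1 (by simp)).mono_left nhdsWithin_le_nhds
    · filter_upwards [self_mem_nhdsWithin] with r hr
      simpa using hr
  refine ht.frequently (Filter.Eventually.frequently ?_)
  filter_upwards [nhdsWithin_le_nhds (lt_mem_nhds one_pos)] with r hr
  have := Complex.integral_cpow_mul_exp_neg_mul_Ioi hw hr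
  simp only [neg_mul]
  rw [this, one_div, Complex.inv_cpow _ _ (by simp [Complex.arg_ofReal_of_nonneg hr.le, Real.pi_ne_zero.symm]),
    mul_comm, div_eq_mul_inv]

/-- Mean value inequality in the parameter on the convex half-plane `Re c ≥ δ`. The factor `x` is
what moves the domain of convergence one unit to the left. -/
lemma norm_exp_sub_exp_le {a b : ℂ} {δ x : ℝ} (ha : δ ≤ a.re) (hb : δ ≤ b.re) (hx : 0 ≤ x) :
    ‖Complex.exp (-a * x) - Complex.exp (-b * x)‖ ≤ ‖a - b‖ * x * Real.exp (-(δ * x)) := by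
  have hd (c : ℂ) : HasDerivAt (fun c : ℂ => Complex.exp (-c * x)) (Complex.exp (-c * x) * -x) c := by
    have : HasDerivAt (fun a : ℂ => -a * x) (-x : ℂ) c := by
      simpa using (hasDerivAt_neg c).mul_const (x : ℂ)
    exact this.cexp
  have := Convex.norm_image_sub_le_of_norm_hasDerivWithin_le (s := {c : ℂ | δ ≤ c.re})
    (C := x * Real.exp (-(δ * x))) (x := b) (y := a)
    (fun c _ => (hd c).hasDerivWithinAt) (fun c hc => ?_) (convex_halfSpace_re_ge δ) hb ha
  · refine this.trans (le_of_eq (by ring))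
  · have hc : δ ≤ c.re := hc
    rw [norm_mul, norm_neg, Complex.norm_of_nonneg hx, mul_comm, Complex.norm_exp]
    have := mul_le_mul_of_nonneg_right hc hx
    gcongr
    simpa using this

lemma integrableOn_cpow_mul_exp_sub_exp {w a b : ℂ} (hw : -1 < w.re) (ha : 0 < a.re)
    (hb : 0 < b.re) :
    IntegrableOn (fun x : ℝ => (x : ℂ) ^ (w - 1) *
      (Complex.exp (-a * x) - Complex.exp (-b * x))) (Ioi 0) := by
  have hδ : 0 < min a.re b.re := lt_min ha hb
  refine ((integrableOn_rpow_mul_exp hw hδ).const_mul ‖a - b‖).mono'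
    (by fun_prop) ?_
  refine (ae_restrict_iff' measurableSet_Ioi).2 (.of_forall fun x hx => ?_)
  have hx : 0 < x := hx
  have h := norm_exp_sub_exp_le (min_le_left a.re b.re) (min_le_right a.re b.re) hx.le
  have e : x ^ w.re = x ^ (w - 1).re * x := by
    rw [← Real.rpow_add_one hx.ne']; simp
  rw [norm_mul, Complex.norm_cpow_eq_rpow_re_of_pos hx, e]
  refine (mul_le_mul_of_nonneg_left h (by positivity)).trans (le_of_eq (by ring))

/-- Integration by parts with antiderivative `x^w / w` reduces to Gamma integrals at `w + 1`; the
boundary terms vanish because the difference of exponentials is `O(x)` at `0` and decays at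
infinity. -/
lemma integral_cpow_mul_exp_sub_exp {w a b : ℂ} (hw : -1 < w.re) (hw0 : w ≠ 0) (ha : 0 < a.re)
    (hb : 0 < b.re) :
    ∫ x in Ioi (0 : ℝ), (x : ℂ) ^ (w - 1) * (Complex.exp (-a * x) - Complex.exp (-b * x)) =
      Complex.Gamma w * (1 / a ^ w - 1 / b ^ w) := by
  have hδ : 0 < min a.re b.re := lt_min ha hb
  set δ := min a.re b.re
  have hD (c : ℂ) (x : ℝ) : HasDerivAt (fun x : ℝ => Complex.exp (-c * x))
      (-c * Complex.exp (-c * x)) x := by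
    have : HasDerivAt (fun x : ℝ => -c * (x : ℂ)) (-c) x := by
      simpa using (Complex.ofRealCLM.hasDerivAt (x := x)).const_mul (-c)
    simpa [mul_comm] using this.cexp
  have hU (x : ℝ) (hx : x ∈ Ioi (0 : ℝ)) :
      HasDerivAt (fun x : ℝ => (x : ℂ) ^ w / w) ((x : ℂ) ^ (w - 1)) x := by
    have hx : 0 < x := hx
    have := (hasDerivAt_ofReal_cpow_const' (r := w - 1) hx.ne' (by simpa [sub_eq_iff_eq_add] using hw0))
    simpa using this
  have hb1 (x : ℝ) (hx : 0 < x) : ‖((fun x : ℝ => (x : ℂ) ^ w / w) * (fun x : ℝ =>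
      Complex.exp (-a * x) - Complex.exp (-b * x))) x‖ ≤
      (‖a - b‖ / ‖w‖) * (x ^ (w.re + 1) * Real.exp (-(δ * x))) := by
    have h := norm_exp_sub_exp_le (min_le_left a.re b.re) (min_le_right a.re b.re) hx.le
    rw [Pi.mul_apply, norm_mul, norm_div, Complex.norm_cpow_eq_rpow_re_of_pos hx,
      Real.rpow_add_one hx.ne']
    refine (mul_le_mul_of_nonneg_left h (by positivity)).trans (le_of_eq (by ring))
  have key := integral_Ioi_mul_deriv_eq_deriv_mul (a := 0) (a' := 0) (b' := 0)
    (u := fun x : ℝ => (x : ℂ) ^ w / w) (u' := fun x : ℝ => (x : ℂ) ^ (w - 1))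
    (v := fun x : ℝ => Complex.exp (-a * x) - Complex.exp (-b * x))
    (v' := fun x : ℝ => -a * Complex.exp (-a * x) - -b * Complex.exp (-b * x))
    hU (fun x _ => (hD a x).sub (hD b x)) ?_ (integrableOn_cpow_mul_exp_sub_exp hw ha hb) ?_ ?_
  · have e : ∀ c : ℂ, 0 < c.re → c * (Complex.Gamma (w + 1) / c ^ (w + 1)) / w =
        Complex.Gamma w * (1 / c ^ w) := by
      intro c hc
      have := ne_zero_of_re_pos hc
      rw [Complex.Gamma_add_one _ hw0, Complex.cpow_add _ _ this, Complex.cpow_one]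
      have : c ^ w ≠ 0 := by simp [Complex.cpow_eq_zero_iff, this]
      field_simp
    have hI (c : ℂ) (hc : 0 < c.re) := integral_cpow_mul_exp (w := w + 1) (a := c)
      (by simpa using by linarith) hc
    simp only [add_sub_cancel_right] at hI
    have h2 : ∫ x in Ioi (0 : ℝ), (x : ℂ) ^ w / w *
        (-a * Complex.exp (-a * x) - -b * Complex.exp (-b * x)) =
        b * (Complex.Gamma (w + 1) / b ^ (w + 1)) / w -
          a * (Complex.Gamma (w + 1) / a ^ (w + 1)) / w := by
      rw [← hI a ha, ← hI b hb, ← integral_const_mul, ← integral_const_mul, ← integral_div,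
        ← integral_div, ← integral_sub]
      · congr 1; ext x; ring
      · exact ((integrableOn_cpow_mul_exp hw hb).const_mul b).div_const w
      · exact ((integrableOn_cpow_mul_exp hw ha).const_mul a).div_const w
    rw [h2, e a ha, e b hb] at key
    linear_combination key
  · have := ((integrableOn_cpow_mul_exp hw hb).const_mul b).div_const w |>.sub
      (((integrableOn_cpow_mul_exp hw ha).const_mul a).div_const w)
    refine this.congr (.of_forall fun x => ?_)
    simp only [Pi.mul_apply, Pi.sub_apply]
    ring
  · refine squeeze_zero_norm' (a := fun x => (‖a - b‖ / ‖w‖) * (x ^ (w.re + 1) *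
      Real.exp (-(δ * x)))) ?_ ?_
    · filter_upwards [self_mem_nhdsWithin] with x hx using hb1 x hx
    · have hc : ContinuousAt (fun x : ℝ => (‖a - b‖ / ‖w‖) * (x ^ (w.re + 1) *
          Real.exp (-(δ * x)))) 0 := by
        refine continuousAt_const.mul ((Real.continuousAt_rpow_const _ _ (.inr (by linarith))).mul
          (by fun_prop))
      have := hc.tendsto
      rw [Real.zero_rpow (by linarith)] at this
      simpa using this.mono_left nhdsWithin_le_nhds
  · refine squeeze_zero_norm' (a := fun x => (‖a - b‖ / ‖w‖) * (x ^ (w.re + 1) *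
      Real.exp (-(δ * x)))) ?_ ?_
    · filter_upwards [Filter.eventually_gt_atTop 0] with x hx using hb1 x hx
    · have := (tendsto_rpow_mul_exp_neg_mul_atTop_nhds_zero (w.re + 1) δ hδ).const_mul
        (‖a - b‖ / ‖w‖)
      simpa using this

/-! ### The cut plane and bounds for the kernel -/

lemma mem_cutPlane_iff (z : ℂ) : z ∈ cutPlane ↔ 1 - z ∈ Complex.slitPlane := by
  rw [cutPlane, mem_compl_iff, not_iff_comm, Complex.mem_slitPlane_iff_not_le_zero, not_not]
  constructor
  · intro h
    refine ⟨z.re, ?_, ?_⟩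
    · simpa using (Complex.le_def.1 h).1
    · apply Complex.ext
      · simp
      · have := (Complex.le_def.1 h).2
        simp at this
        simp [this]
  · rintro ⟨r, hr, rfl⟩
    have hr : 1 ≤ r := hr
    rw [Complex.le_def]
    simpa using hr

lemma cutPlane_eq_preimage : cutPlane = (fun z : ℂ => 1 - z) ⁻¹' Complex.slitPlane := by
  ext z
  exact mem_cutPlane_iff z

lemma isOpen_cutPlane : IsOpen cutPlane := by
  rw [cutPlane_eq_preimage]
  exact Complex.isOpen_slitPlane.preimage (by fun_prop)

lemma isPreconnected_cutPlane : IsPreconnected cutPlane := by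
  have e : cutPlane = (fun z : ℂ => 1 - z) '' Complex.slitPlane := by
    ext z
    rw [mem_cutPlane_iff]
    exact ⟨fun h => ⟨1 - z, h, by simp⟩, by rintro ⟨y, hy, rfl⟩; simpa using hy⟩
  rw [e]
  exact (Complex.starConvex_one_slitPlane.isPathConnected
    Complex.one_mem_slitPlane).isConnected.isPreconnected.image _ (by fun_prop)

lemma mem_cutPlane_of_norm_lt_one {z : ℂ} (hz : ‖z‖ < 1) : z ∈ cutPlane := by
  rw [mem_cutPlane_iff, Complex.mem_slitPlane_iff]
  left
  simpa using (Complex.re_le_norm z).trans_lt hz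

lemma ne_one_of_mem_cutPlane {z : ℂ} (hz : z ∈ cutPlane) : z ≠ 1 := by
  rintro rfl
  simp [mem_cutPlane_iff] at hz

lemma one_sub_mul_ne_zero_of_mem_cutPlane {z : ℂ} (hz : z ∈ cutPlane) {t : ℝ} (ht : t ∈ Icc (0 : ℝ) 1) :
    1 - z * t ≠ 0 := by
  intro h
  have ht0 : t ≠ 0 := by rintro rfl; simp at h
  have ht1 : 0 < t := lt_of_le_of_ne ht.1 ht0.symm
  refine hz ⟨t⁻¹, (one_le_inv₀ ht1).2 ht.2, ?_⟩
  have : (t : ℂ) ≠ 0 := by exact_mod_cast ht0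
  push_cast
  field_simp
  linear_combination h

/-- A nonvanishing continuous function on the compact set (closed disc) × `[0, 1]` attains a
positive minimum of its modulus. -/
lemma exists_kernel_lower_bound {z₀ : ℂ} (hz₀ : z₀ ∈ cutPlane) :
    ∃ U ∈ nhds z₀, ∃ c : ℝ, 0 < c ∧ U ⊆ cutPlane ∧
      ∀ z ∈ U, ∀ t ∈ Icc (0 : ℝ) 1, c ≤ ‖1 - z * t‖ := by
  obtain ⟨ε, hε, hsub⟩ := Metric.nhds_basis_closedBall.mem_iff.1 (isOpen_cutPlane.mem_nhds hz₀)
  have hK : IsCompact (Metric.closedBall z₀ ε ×ˢ Icc (0 : ℝ) 1) :=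
    (isCompact_closedBall z₀ ε).prod isCompact_Icc
  obtain ⟨p, hp, hmin⟩ := hK.exists_isMinOn ⟨(z₀, 0), by simp [hε.le]⟩
    (f := fun p : ℂ × ℝ => ‖1 - p.1 * p.2‖) (by fun_prop)
  refine ⟨_, Metric.closedBall_mem_nhds z₀ hε, _, norm_pos_iff.2
    (one_sub_mul_ne_zero_of_mem_cutPlane (hsub hp.1) hp.2), hsub, fun z hz t ht => ?_⟩
  exact hmin (show (z, t) ∈ _ from ⟨hz, ht⟩)

lemma exp_neg_mem_Icc {x : ℝ} (hx : 0 < x) : Real.exp (-x) ∈ Icc (0 : ℝ) 1 :=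
  ⟨(Real.exp_pos _).le, by simpa using hx.le⟩

/-- The weight `(1 - z e^{-x})⁻¹`. -/
noncomputable def kernel (z : ℂ) (x : ℝ) : ℂ := (1 - z * Real.exp (-x))⁻¹

lemma measurable_kernel (z : ℂ) : Measurable (kernel z) := by
  unfold kernel
  fun_prop

/-- The integral of an integrable function against `kernel z` is holomorphic in `z`. -/
lemma differentiableOn_integral_mul_kernel {h : ℝ → ℂ} (hh : IntegrableOn h (Ioi 0)) :
    DifferentiableOn ℂ (fun z => ∫ x in Ioi (0 : ℝ), h x * kernel z x) cutPlane := by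
  intro z₀ hz₀
  obtain ⟨U, hU, c, hc, hsub, hbd⟩ := exists_kernel_lower_bound hz₀
  have hk : ∀ z ∈ U, ∀ x : ℝ, 0 < x → ‖kernel z x‖ ≤ c⁻¹ := fun z hz x hx => by
    rw [kernel, norm_inv]
    exact inv_anti₀ hc (hbd z hz _ (exp_neg_mem_Icc hx))
  have hmeas (z : ℂ) : AEStronglyMeasurable (fun x => h x * kernel z x)
      (volume.restrict (Ioi 0)) :=
    hh.aestronglyMeasurable.mul (measurable_kernel z).aestronglyMeasurable
  refine ((hasDerivAt_integral_of_dominated_loc_of_deriv_le (𝕜 := ℂ)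
    (F' := fun z x => h x * (kernel z x ^ 2 * Real.exp (-x)))
    (bound := fun x => ‖h x‖ * (c⁻¹ ^ 2 * 1)) hU
    (.of_forall hmeas) ?_ ?_ ?_ (hh.norm.mul_const _) ?_).2.differentiableAt).differentiableWithinAt
  · refine (hh.norm.mul_const c⁻¹).mono' (hmeas z₀) ?_
    refine (ae_restrict_iff' measurableSet_Ioi).2 (.of_forall fun x hx => ?_)
    rw [norm_mul]
    exact mul_le_mul_of_nonneg_left (hk z₀ (mem_of_mem_nhds hU) x hx) (norm_nonneg _)
  · refine hh.aestronglyMeasurable.mul (Measurable.aestronglyMeasurable ?_)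
    exact ((measurable_kernel z₀).pow_const 2).mul (by fun_prop)
  · refine (ae_restrict_iff' measurableSet_Ioi).2 (.of_forall fun x hx z hz => ?_)
    rw [norm_mul, norm_mul, norm_pow, Complex.norm_of_nonneg (Real.exp_pos _).le]
    gcongr
    · exact hk z hz x hx
    · exact (exp_neg_mem_Icc hx).2
  · refine (ae_restrict_iff' measurableSet_Ioi).2 (.of_forall fun x hx z hz => ?_)
    have hne := one_sub_mul_ne_zero_of_mem_cutPlane (hsub hz) (exp_neg_mem_Icc hx)
    have h1 : HasDerivAt (fun z : ℂ => 1 - z * (Real.exp (-x) : ℂ)) (-(Real.exp (-x) : ℂ)) z := by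
      simpa using ((hasDerivAt_id z).mul_const (Real.exp (-x) : ℂ)).const_sub 1
    refine ((h1.inv hne).const_mul (h x)).congr_deriv ?_
    rw [kernel, inv_pow]
    ring

/-- The kernel of `z` does not vanish and is bounded by a multiple of `1 + x ^ (-κ)`. -/
def HasKernelBound (z : ℂ) (κ : ℝ) : Prop :=
  0 ≤ κ ∧ ∃ C : ℝ, 0 ≤ C ∧ ∀ x : ℝ, 0 < x →
    1 - z * Real.exp (-x) ≠ 0 ∧ ‖kernel z x‖ ≤ C * (1 + x ^ (-κ))

lemma hasKernelBound_of_mem_cutPlane {z : ℂ} (hz : z ∈ cutPlane) : HasKernelBound z 0 := by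
  obtain ⟨U, hU, c, hc, hsub, hbd⟩ := exists_kernel_lower_bound hz
  refine ⟨le_rfl, c⁻¹, by positivity, fun x hx => ⟨one_sub_mul_ne_zero_of_mem_cutPlane hz
    (exp_neg_mem_Icc hx), ?_⟩⟩
  have : ‖kernel z x‖ ≤ c⁻¹ := by
    rw [kernel, norm_inv]
    exact inv_anti₀ hc (hbd z (mem_of_mem_nhds hU) _ (exp_neg_mem_Icc hx))
  refine this.trans ?_
  have : 0 < c⁻¹ := by positivity
  simp
  linarith

/-- From `e^{-x} ≤ 1/(1+x)` one gets `1/(1 - e^{-x}) ≤ 1 + 1/x`; the simple pole at `0` costs the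
exponent `κ = 1`. -/
lemma hasKernelBound_one : HasKernelBound 1 1 := by
  refine ⟨zero_le_one, 1, zero_le_one, fun x hx => ?_⟩
  have h1 : Real.exp (-x) < 1 := by simpa using hx
  have e : (1 - 1 * (Real.exp (-x) : ℂ)) = ((1 - Real.exp (-x) : ℝ) : ℂ) := by push_cast; ring
  have hpos : 0 < 1 - Real.exp (-x) := by linarith
  refine ⟨by rw [e]; exact_mod_cast hpos.ne', ?_⟩
  rw [kernel, e, norm_inv, Complex.norm_of_nonneg hpos.le, Real.rpow_neg_one, one_mul]
  have h2 : Real.exp (-x) ≤ 1 / (1 + x) := by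
    rw [Real.exp_neg, ← one_div]
    exact one_div_le_one_div_of_le (by linarith) (by linarith [Real.add_one_le_exp x])
  have h3 : x / (1 + x) ≤ 1 - Real.exp (-x) := by
    have : x / (1 + x) = 1 - 1 / (1 + x) := by field_simp; ring
    linarith
  calc (1 - Real.exp (-x))⁻¹ ≤ (x / (1 + x))⁻¹ := inv_anti₀ (by positivity) h3
    _ = 1 + x⁻¹ := by field_simp; ring

lemma integrableOn_rpow_mul_exp_mul_kernel {z : ℂ} {κ r δ : ℝ} (hz : HasKernelBound z κ)
    (hr : κ - 1 < r) (hδ : 0 < δ) :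
    IntegrableOn (fun x => x ^ r * Real.exp (-(δ * x)) * ‖kernel z x‖) (Ioi 0) := by
  obtain ⟨hκ, C, hC, h⟩ := hz
  refine (((integrableOn_rpow_mul_exp (r := r) (by linarith) hδ).add
    (integrableOn_rpow_mul_exp (r := r - κ) (by linarith) hδ)).const_mul C).mono'
    (((measurable_id.pow_const r).mul (by fun_prop)).mul
      (measurable_kernel z).norm).aestronglyMeasurable ?_
  refine (ae_restrict_iff' measurableSet_Ioi).2 (.of_forall fun x hx => ?_)
  have hx : 0 < x := hx
  rw [Real.norm_of_nonneg (by positivity)]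
  refine (mul_le_mul_of_nonneg_left (h x hx).2 (by positivity)).trans (le_of_eq ?_)
  simp only [Pi.add_apply, sub_eq_add_neg, Real.rpow_add hx]
  ring

/-! ### The Mellin transforms and their expansions in powers of `z` -/

/-- The Mellin transform of `e^{-ux} / (1 - z e^{-x})`. -/
noncomputable def lerchIntegral (z w u : ℂ) : ℂ :=
  ∫ x in Ioi (0 : ℝ), (x : ℂ) ^ (w - 1) * Complex.exp (-u * x) * kernel z x

/-- The Mellin transform of `(e^{-vx} - e^{-ux}) / (1 - z e^{-x})`. -/
noncomputable def lerchDiffIntegral (z w v u : ℂ) : ℂ :=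
  ∫ x in Ioi (0 : ℝ), (x : ℂ) ^ (w - 1) * (Complex.exp (-v * x) - Complex.exp (-u * x)) * kernel z x

lemma integrableOn_lerchIntegral {z w u : ℂ} {κ : ℝ} (hz : HasKernelBound z κ)
    (hw : κ < w.re) (hu : 0 < u.re) :
    IntegrableOn (fun x : ℝ => (x : ℂ) ^ (w - 1) * Complex.exp (-u * x) * kernel z x) (Ioi 0) := by
  refine (integrableOn_rpow_mul_exp_mul_kernel (r := (w - 1).re) hz (by simpa using hw) hu).mono'
    ((measurable_cpow_mul_exp _ u).mul (measurable_kernel z)).aestronglyMeasurable ?_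
  refine (ae_restrict_iff' measurableSet_Ioi).2 (.of_forall fun x hx => ?_)
  rw [norm_mul, norm_cpow_mul_exp hx]

lemma norm_cpow_mul_exp_sub_exp_le {w a b : ℂ} {δ x : ℝ} (ha : δ ≤ a.re) (hb : δ ≤ b.re)
    (hx : 0 < x) :
    ‖(x : ℂ) ^ (w - 1) * (Complex.exp (-a * x) - Complex.exp (-b * x))‖ ≤
      ‖a - b‖ * (x ^ w.re * Real.exp (-(δ * x))) := by
  have e : x ^ w.re = x ^ (w - 1).re * x := by
    rw [← Real.rpow_add_one hx.ne']; simp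
  rw [norm_mul, Complex.norm_cpow_eq_rpow_re_of_pos hx, e]
  exact (mul_le_mul_of_nonneg_left (norm_exp_sub_exp_le ha hb hx.le) (by positivity)).trans
    (le_of_eq (by ring))

/-- The function transformed is `O(x^(1-κ))` at `0` and decays exponentially, so its Mellin
transform is holomorphic for `Re w > κ - 1`. -/
lemma differentiableAt_lerchDiffIntegral {z w v u : ℂ} {κ : ℝ} (hz : HasKernelBound z κ)
    (hw : κ - 1 < w.re) (hv : 0 < v.re) (hu : 0 < u.re) :
    DifferentiableAt ℂ (fun w => lerchDiffIntegral z w v u) w := by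
  obtain ⟨hκ, C, hC, h⟩ := hz
  have hδ : 0 < min v.re u.re := lt_min hv hu
  set δ := min v.re u.re with hδd
  set f : ℝ → ℂ := fun x => (Complex.exp (-v * x) - Complex.exp (-u * x)) * kernel z x with hf
  have hfb : ∀ x : ℝ, 0 < x →
      ‖f x‖ ≤ ‖v - u‖ * x * Real.exp (-(δ * x)) * (C * (1 + x ^ (-κ))) := by
    intro x hx
    rw [hf, norm_mul]
    exact mul_le_mul (norm_exp_sub_exp_le (min_le_left _ _) (min_le_right _ _) hx.le) (h x hx).2
      (norm_nonneg _) (by positivity)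
  have e : (fun w => lerchDiffIntegral z w v u) = mellin f := by
    ext w
    simp [mellin, lerchDiffIntegral, hf, mul_assoc]
  rw [e]
  -- Any `a > Re w` would serve, since the decay at infinity beats every power.
  refine mellin_differentiableAt_of_isBigO_rpow (a := w.re + 1) (b := κ - 1) ?_ ?_ (by linarith)
    ?_ hw
  · refine ContinuousOn.locallyIntegrableOn (fun x hx => ContinuousAt.continuousWithinAt ?_)
      measurableSet_Ioi
    have hk : ContinuousAt (kernel z) x := by
      unfold kernel
      exact ContinuousAt.inv₀ (by fun_prop) (h x hx).1
    exact ContinuousAt.mul (by fun_prop) hk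
  · have hO : f =O[Filter.atTop] fun x : ℝ => x ^ (1 : ℝ) * Real.exp (-δ * x) := by
      refine Asymptotics.IsBigO.of_bound (‖v - u‖ * (C * 2)) ?_
      filter_upwards [Filter.eventually_ge_atTop 1] with x hx
      have hx0 : 0 < x := by linarith
      refine (hfb x hx0).trans ?_
      have : x ^ (-κ) ≤ 1 := Real.rpow_le_one_of_one_le_of_nonpos hx (by linarith)
      rw [Real.norm_of_nonneg (by positivity), Real.rpow_one, ← neg_mul]
      calc ‖v - u‖ * x * Real.exp (-δ * x) * (C * (1 + x ^ (-κ)))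
          ≤ ‖v - u‖ * x * Real.exp (-δ * x) * (C * (1 + 1)) := by gcongr
        _ = _ := by ring
    refine hO.trans ?_
    have h2 := (isLittleO_exp_neg_mul_rpow_atTop hδ (-(w.re + 1) - 1)).isBigO
    refine ((Asymptotics.isBigO_refl (fun x : ℝ => x ^ (1 : ℝ)) _).mul h2).congr' .rfl ?_
    filter_upwards [Filter.eventually_gt_atTop 0] with x hx
    rw [← Real.rpow_add hx]
    congr 1
    ring
  · refine Asymptotics.IsBigO.of_bound (‖v - u‖ * (C * 2)) ?_
    filter_upwards [self_mem_nhdsWithin, nhdsWithin_le_nhds (Iio_mem_nhds (zero_lt_one' ℝ))] with x hx hx1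
    have hx : 0 < x := hx
    refine (hfb x hx).trans ?_
    have h1 : 1 ≤ x ^ (-κ) := Real.one_le_rpow_of_pos_of_le_one_of_nonpos hx hx1.le (by linarith)
    have h2 : Real.exp (-(δ * x)) ≤ 1 := by
      rw [Real.exp_le_one_iff]
      have := mul_pos hδ hx
      linarith
    rw [Real.norm_of_nonneg (by positivity), show -(κ - 1) = 1 + -κ by ring, Real.rpow_add hx,
      Real.rpow_one]
    calc ‖v - u‖ * x * Real.exp (-(δ * x)) * (C * (1 + x ^ (-κ)))
        ≤ ‖v - u‖ * x * 1 * (C * (x ^ (-κ) + x ^ (-κ))) := by gcongr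
      _ = _ := by ring

/-- Expanding the kernel in powers of `z`. -/
lemma hasSum_integral_mul_kernel {h : ℝ → ℂ} {z : ℂ} (hz : ‖z‖ ≤ 1)
    (hi : ∀ n : ℕ, IntegrableOn (fun x => h x * Complex.exp (-n * x)) (Ioi 0))
    (hs : Summable fun n : ℕ => ‖z‖ ^ n * ∫ x in Ioi (0 : ℝ), ‖h x * Complex.exp (-n * x)‖) :
    HasSum (fun n : ℕ => z ^ n * ∫ x in Ioi (0 : ℝ), h x * Complex.exp (-n * x))
      (∫ x in Ioi (0 : ℝ), h x * kernel z x) := by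
  have := hasSum_integral_of_summable_integral_norm (μ := volume.restrict (Ioi (0 : ℝ)))
    (F := fun (n : ℕ) x => z ^ n * (h x * Complex.exp (-n * x)))
    (fun n => (hi n).const_mul _) (by simpa only [norm_mul _ (_ * _), norm_pow, integral_const_mul] using hs)
  simp only [integral_const_mul] at this
  suffices he : ∫ x in Ioi (0 : ℝ), h x * kernel z x =
      ∫ x in Ioi (0 : ℝ), ∑' n : ℕ, z ^ n * (h x * Complex.exp (-n * x)) by
    rw [he]
    exact this
  refine setIntegral_congr_fun measurableSet_Ioi fun x hx => ?_
  have hx : 0 < x := hx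
  have hlt : ‖z * Real.exp (-x)‖ < 1 := by
    rw [norm_mul, Complex.norm_of_nonneg (Real.exp_pos _).le]
    have h1 : Real.exp (-x) < 1 := by simpa using hx
    nlinarith [Real.exp_pos (-x)]
  rw [kernel, ← tsum_geometric_of_norm_lt_one hlt, ← tsum_mul_left]
  refine tsum_congr fun n => ?_
  rw [mul_pow, ← Complex.ofReal_pow, ← Real.exp_nat_mul]
  push_cast
  rw [show (-(n : ℂ) * x) = n * -x by ring]
  ring

lemma summable_pow_mul_one_div_rpow {q r δ : ℝ} (hq0 : 0 ≤ q) (hδ : 0 < δ)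
    (h : (q < 1 ∧ 0 ≤ r) ∨ (q ≤ 1 ∧ 1 < r)) :
    Summable fun n : ℕ => q ^ n * (1 / (δ + n) ^ r) := by
  rcases h with ⟨hq, hr⟩ | ⟨hq, hr⟩
  · refine ((summable_geometric_of_lt_one hq0 hq).mul_right (1 / δ ^ r)).of_nonneg_of_le
      (fun n => by positivity) fun n => ?_
    gcongr
    simp
  · have := (Real.summable_one_div_nat_add_rpow δ r).2 hr
    refine this.of_nonneg_of_le (fun n => by positivity) fun n => ?_
    rw [abs_of_pos (by positivity), add_comm (n : ℝ)]
    exact mul_le_of_le_one_left (by positivity) (pow_le_one₀ hq0 hq)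

lemma integral_rpow_mul_exp {r δ : ℝ} (hr : -1 < r) (hδ : 0 < δ) :
    ∫ x in Ioi (0 : ℝ), x ^ r * Real.exp (-(δ * x)) = 1 / δ ^ (r + 1) * Real.Gamma (r + 1) := by
  have := Real.integral_rpow_mul_exp_neg_mul_Ioi (a := r + 1) (by linarith) hδ
  rw [add_sub_cancel_right] at this
  rw [this, Real.div_rpow zero_le_one hδ.le, Real.one_rpow]

lemma exp_neg_mul_exp_nat (u : ℂ) (n : ℕ) (x : ℝ) :
    Complex.exp (-u * x) * Complex.exp (-n * x) = Complex.exp (-(u + n) * x) := by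
  rw [← Complex.exp_add]
  ring_nf

lemma re_add_nat (u : ℂ) (n : ℕ) : (u + n).re = u.re + n := by simp

lemma re_add_nat_pos {u : ℂ} (hu : 0 < u.re) (n : ℕ) : 0 < (u + n).re := by
  rw [re_add_nat]
  positivity

lemma hasSum_lerchIntegral {z w u : ℂ} (hw : 0 < w.re) (hu : 0 < u.re)
    (hz : ‖z‖ < 1 ∨ (‖z‖ ≤ 1 ∧ 1 < w.re)) :
    HasSum (fun n : ℕ => Complex.Gamma w * (z ^ n / (u + n) ^ w)) (lerchIntegral z w u) := by
  have e (n : ℕ) : (fun x : ℝ => (x : ℂ) ^ (w - 1) * Complex.exp (-u * x) * Complex.exp (-n * x)) =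
      fun x : ℝ => (x : ℂ) ^ (w - 1) * Complex.exp (-(u + n) * x) := by
    ext x
    rw [mul_assoc, exp_neg_mul_exp_nat]
  have hw' : -1 < (w - 1).re := by simpa using hw
  have key := hasSum_integral_mul_kernel (z := z)
    (h := fun x : ℝ => (x : ℂ) ^ (w - 1) * Complex.exp (-u * x)) (hz.elim le_of_lt And.left)
    (fun n => by simpa only [e] using integrableOn_cpow_mul_exp hw' (re_add_nat_pos hu n)) ?_
  · refine key.congr_fun fun n => ?_
    rw [e, integral_cpow_mul_exp hw (re_add_nat_pos hu n)]
    ring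
  · have hI (n : ℕ) : ∫ x in Ioi (0 : ℝ),
        ‖(x : ℂ) ^ (w - 1) * Complex.exp (-u * x) * Complex.exp (-n * x)‖ =
          1 / (u.re + n) ^ w.re * Real.Gamma w.re := by
      have := integral_rpow_mul_exp hw' (re_add_nat_pos hu n)
      rw [re_add_nat] at this
      rw [setIntegral_congr_fun (g := fun x => x ^ (w - 1).re * Real.exp (-((u.re + n) * x)))
        measurableSet_Ioi fun x hx => ?_, this]
      · simp
      · simp only [congrFun (e n) x]
        rw [norm_cpow_mul_exp hx, re_add_nat]
    simp only [hI, ← mul_assoc]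
    exact (summable_pow_mul_one_div_rpow (norm_nonneg z) hu
      (hz.imp (fun h => ⟨h, hw.le⟩) id)).mul_right _

/-- The `n`-th integral is `O((δ + n)^(-(Re w + 1)))`, one power better than for a single
exponential, so on `|z| = 1` already `Re w > 0` suffices. -/
lemma hasSum_lerchDiffIntegral {z w v u : ℂ} (hw : -1 < w.re) (hw0 : w ≠ 0) (hv : 0 < v.re)
    (hu : 0 < u.re) (hz : ‖z‖ < 1 ∨ (‖z‖ ≤ 1 ∧ 0 < w.re)) :
    HasSum (fun n : ℕ => Complex.Gamma w * (z ^ n / (v + n) ^ w - z ^ n / (u + n) ^ w))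
      (lerchDiffIntegral z w v u) := by
  have e (n : ℕ) : (fun x : ℝ => (x : ℂ) ^ (w - 1) *
      (Complex.exp (-v * x) - Complex.exp (-u * x)) * Complex.exp (-n * x)) =
      fun x : ℝ => (x : ℂ) ^ (w - 1) *
        (Complex.exp (-(v + n) * x) - Complex.exp (-(u + n) * x)) := by
    ext x
    rw [← exp_neg_mul_exp_nat, ← exp_neg_mul_exp_nat]
    ring
  have hint (n : ℕ) := integrableOn_cpow_mul_exp_sub_exp hw (re_add_nat_pos hv n)
    (re_add_nat_pos hu n)
  have key := hasSum_integral_mul_kernel (z := z) (h := fun x : ℝ => (x : ℂ) ^ (w - 1) *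
      (Complex.exp (-v * x) - Complex.exp (-u * x))) (hz.elim le_of_lt And.left)
    (fun n => by simpa only [e] using hint n) ?_
  · refine key.congr_fun fun n => ?_
    rw [e, integral_cpow_mul_exp_sub_exp hw hw0 (re_add_nat_pos hv n) (re_add_nat_pos hu n)]
    ring
  · have hδ : 0 < min v.re u.re := lt_min hv hu
    set δ := min v.re u.re
    have hI (n : ℕ) : ∫ x in Ioi (0 : ℝ), ‖(x : ℂ) ^ (w - 1) *
        (Complex.exp (-v * x) - Complex.exp (-u * x)) * Complex.exp (-n * x)‖ ≤
          1 / (δ + n) ^ (w.re + 1) * (Real.Gamma (w.re + 1) * ‖v - u‖) := by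
      have hδn : 0 < δ + n := by positivity
      rw [← mul_assoc, ← integral_rpow_mul_exp hw hδn, mul_comm, ← integral_const_mul]
      refine setIntegral_mono_on (by have h := hint n; rw [← e] at h; exact h.norm)
        ((integrableOn_rpow_mul_exp hw hδn).const_mul _) measurableSet_Ioi fun x hx => ?_
      simp only [congrFun (e n) x]
      refine (norm_cpow_mul_exp_sub_exp_le (δ := δ + n) ?_ ?_ hx).trans (by simp)
      · rw [re_add_nat]; gcongr; exact min_le_left _ _
      · rw [re_add_nat]; gcongr; exact min_le_right _ _
    refine ((summable_pow_mul_one_div_rpow (r := w.re + 1) (norm_nonneg z) hδ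
      (hz.imp (fun h => ⟨h, by linarith⟩) fun h => ⟨h.1, by linarith⟩)).mul_right
      (Real.Gamma (w.re + 1) * ‖v - u‖)).of_nonneg_of_le (fun n => by positivity) fun n => ?_
    rw [mul_assoc]
    exact mul_le_mul_of_nonneg_left (hI n) (by positivity)

/-- As `-Re w < 1`, the coefficients grow at most linearly in `n`, which the geometric factor
absorbs. The constant `exp (π |Im w|)` bounds the contribution of the argument to the complex power.
-/
lemma summable_lerchSeries {z w u : ℂ} (hz : ‖z‖ < 1) (hw : -1 < w.re) (hu : 0 < u.re) :
    Summable fun n : ℕ => z ^ n / (u + n) ^ w := by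
  have hq : ‖(‖z‖ : ℝ)‖ < 1 := by simpa using hz
  have h1 := summable_pow_mul_geometric_of_norm_lt_one 1 hq
  have h0 := summable_geometric_of_norm_lt_one hq
  refine Summable.of_norm_bounded (g := fun n : ℕ =>
    (u.re ^ (-w.re) + 1 + ‖u‖) * Real.exp (Real.pi * |w.im|) * ‖z‖ ^ n +
      Real.exp (Real.pi * |w.im|) * ((n : ℝ) ^ 1 * ‖z‖ ^ n))
    ((h0.mul_left _).add (h1.mul_left _)) fun n => ?_
  have hne := ne_zero_of_re_pos (re_add_nat_pos hu n)
  have hpos : 0 < ‖u + n‖ := norm_pos_iff.2 hne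
  have hge : u.re ≤ ‖u + n‖ := by
    refine le_trans ?_ (Complex.re_le_norm _)
    rw [re_add_nat]
    simp
  have hle : ‖u + n‖ ≤ ‖u‖ + n := (norm_add_le _ _).trans (by simp)
  have h2 : ‖u + n‖ ^ (-w.re) ≤ u.re ^ (-w.re) + 1 + ‖u + n‖ := by
    rcases le_total 0 w.re with h | h
    · have := Real.rpow_le_rpow_of_nonpos hu hge (neg_nonpos.2 h)
      linarith
    · have hup := Real.rpow_nonneg hu.le (-w.re)
      rcases le_total ‖u + n‖ 1 with h' | h'
      · have := Real.rpow_le_one hpos.le h' (neg_nonneg.2 h)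
        linarith
      · have := Real.rpow_le_rpow_of_exponent_le h' (show -w.re ≤ 1 by linarith)
        rw [Real.rpow_one] at this
        linarith
  have h3 : ‖1 / (u + n) ^ w‖ ≤ ‖u + n‖ ^ (-w.re) * Real.exp (Real.pi * |w.im|) := by
    rw [norm_div, norm_one, Complex.norm_cpow_of_ne_zero hne, Real.rpow_neg hpos.le, one_div_div,
      div_eq_mul_inv, mul_comm]
    refine mul_le_mul_of_nonneg_left (Real.exp_le_exp.2 ?_) (by positivity)
    calc (u + n).arg * w.im ≤ |(u + n).arg * w.im| := le_abs_self _
      _ = |(u + n).arg| * |w.im| := abs_mul _ _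
      _ ≤ _ := by gcongr; exact Complex.abs_arg_le_pi _
  rw [div_eq_mul_one_div, norm_mul, norm_pow]
  calc ‖z‖ ^ n * ‖1 / (u + n) ^ w‖
      ≤ ‖z‖ ^ n * ((u.re ^ (-w.re) + 1 + (‖u‖ + n)) * Real.exp (Real.pi * |w.im|)) := by
        gcongr
        exact h3.trans (mul_le_mul_of_nonneg_right (by linarith) (Real.exp_pos _).le)
    _ = _ := by ring

/-! ### Uniqueness of the analytic continuation -/

/-- Four convex pieces surround the puncture: above the real axis, right of `1`, below the axis,
left of `1`. They are glued at explicit common points. -/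
lemma isPreconnected_halfPlane_diff_one {σ : ℝ} (hσ : σ < 1) :
    IsPreconnected {t : ℂ | σ < t.re ∧ t ≠ 1} := by
  have hA : IsPreconnected ({t : ℂ | σ < t.re} ∩ {t : ℂ | 0 < t.im}) :=
    ((convex_halfSpace_re_gt σ).inter (convex_halfSpace_im_gt 0)).isPreconnected
  have hB : IsPreconnected {t : ℂ | 1 < t.re} := (convex_halfSpace_re_gt 1).isPreconnected
  have hC : IsPreconnected ({t : ℂ | σ < t.re} ∩ {t : ℂ | t.im < 0}) :=
    ((convex_halfSpace_re_gt σ).inter (convex_halfSpace_im_lt 0)).isPreconnected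
  have hD : IsPreconnected ({t : ℂ | σ < t.re} ∩ {t : ℂ | t.re < 1}) :=
    ((convex_halfSpace_re_gt σ).inter (convex_halfSpace_re_lt 1)).isPreconnected
  have hAB := hA.union (2 + Complex.I)
    (by constructor <;> simp; linarith) (by simp) hB
  have hABC := hAB.union (2 - Complex.I) (by right; simp) (by constructor <;> simp; linarith) hC
  have hall := hABC.union (((σ + 1) / 2 : ℝ) + Complex.I)
    (by left; left; constructor <;> simp; linarith) (by constructor <;> simp <;> linarith) hD
  convert hall using 1
  ext t
  simp only [mem_ofPred_eq, mem_union, mem_inter_iff, ne_eq, Complex.ext_iff, Complex.one_re,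
    Complex.one_im]
  constructor
  · rintro ⟨h1, h2⟩
    rcases lt_trichotomy t.re 1 with h | h | h
    · exact .inr ⟨h1, h⟩
    · rcases lt_trichotomy t.im 0 with h' | h' | h'
      · exact .inl (.inr ⟨h1, h'⟩)
      · exact absurd ⟨h, h'⟩ h2
      · exact .inl (.inl (.inl ⟨h1, h'⟩))
    · exact .inl (.inl (.inr h))
  · rintro (((⟨h1, h2⟩ | h) | ⟨h1, h2⟩) | ⟨h1, h2⟩)
    · exact ⟨h1, fun h => h2.ne' h.2⟩
    · exact ⟨by linarith, fun h' => h.ne' h'.1⟩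
    · exact ⟨h1, fun h => h2.ne h.2⟩
    · exact ⟨h1, fun h => h2.ne h.1⟩

lemma isOpen_halfPlane_diff_one (σ : ℝ) : IsOpen {t : ℂ | σ < t.re ∧ t ≠ 1} :=
  (isOpen_lt continuous_const Complex.continuous_re).inter isOpen_ne

lemma IsLerchValue.unique {z s u w₁ w₂ : ℂ} (h₁ : IsLerchValue z s u w₁)
    (h₂ : IsLerchValue z s u w₂) : w₁ = w₂ := by
  rcases h₁ with ⟨hz, f, hf, hfs, rfl⟩ | ⟨rfl, hs, σ, hσ, f, hf, hfs, rfl⟩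
  · rcases h₂ with ⟨-, g, hg, hgs, rfl⟩ | ⟨rfl, -⟩
    · refine (hf.analyticOnNhd isOpen_cutPlane).eqOn_of_preconnected_of_eventuallyEq
        (hg.analyticOnNhd isOpen_cutPlane) isPreconnected_cutPlane (z₀ := 0)
        (mem_cutPlane_of_norm_lt_one (by simp)) ?_ hz
      filter_upwards [Metric.ball_mem_nhds (0 : ℂ) one_pos] with y hy
      have hy : ‖y‖ < 1 := by simpa using hy
      rw [hfs y hy, hgs y hy]
    · exact absurd rfl (ne_one_of_mem_cutPlane hz)
  · rcases h₂ with ⟨hz, -⟩ | ⟨-, -, τ, hτ, g, hg, hgs, rfl⟩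
    · exact absurd rfl (ne_one_of_mem_cutPlane hz)
    · by_cases h1 : 1 < s.re
      · rw [hfs s h1, hgs s h1]
      -- The two continuations may live on different half-planes, so they are compared on the
      -- smaller one.
      · have hf' : DifferentiableOn ℂ f {t : ℂ | max σ τ < t.re ∧ t ≠ 1} := hf.mono
          fun t ht => ⟨(le_max_left _ _).trans_lt ht.1, ht.2⟩
        have hg' : DifferentiableOn ℂ g {t : ℂ | max σ τ < t.re ∧ t ≠ 1} := hg.mono
          fun t ht => ⟨(le_max_right _ _).trans_lt ht.1, ht.2⟩
        have hm : max σ τ < 1 := max_lt (by linarith) (by linarith)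
        refine (hf'.analyticOnNhd (isOpen_halfPlane_diff_one _)).eqOn_of_preconnected_of_eventuallyEq
          (hg'.analyticOnNhd (isOpen_halfPlane_diff_one _)) (isPreconnected_halfPlane_diff_one hm)
          (z₀ := 2) ⟨?_, by norm_num⟩ ?_ ⟨max_lt hσ hτ, hs⟩
        · simp only [Complex.re_ofNat]; linarith
        · filter_upwards [(isOpen_lt continuous_const Complex.continuous_re).mem_nhds
            (show (1 : ℝ) < (2 : ℂ).re by norm_num)] with t ht
          rw [hfs t ht, hgs t ht]

lemma IsLerchValue.lerchPhi_eq {z s u w : ℂ} (h : IsLerchValue z s u w) : lerchPhi z s u = w := by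
  have hex : ∃ w, IsLerchValue z s u w := ⟨w, h⟩
  rw [lerchPhi, dif_pos hex]
  exact hex.choose_spec.unique h

/-! ### Integral representations of the Lerch transcendent -/

lemma Gamma_ne_zero_of_neg_one_lt_re {w : ℂ} (hw : -1 < w.re) (hw0 : w ≠ 0) :
    Complex.Gamma w ≠ 0 := by
  refine Complex.Gamma_ne_zero fun n hn => ?_
  rcases n with _ | n
  · simp at hn
    exact hw0 hn
  · rw [hn] at hw
    simp at hw
    linarith [(n.cast_nonneg : (0 : ℝ) ≤ n)]

lemma lerchIntegral_eq_Gamma_mul_lerchSeries {z w u : ℂ} (hw : 0 < w.re) (hu : 0 < u.re)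
    (hz : ‖z‖ < 1 ∨ (‖z‖ ≤ 1 ∧ 1 < w.re)) :
    lerchIntegral z w u = Complex.Gamma w * lerchSeries z w u := by
  rw [lerchSeries, ← tsum_mul_left, (hasSum_lerchIntegral hw hu hz).tsum_eq]

lemma summable_lerchSeries_one {w u : ℂ} (hw : 1 < w.re) (hu : 0 < u.re) :
    Summable fun n : ℕ => (1 : ℂ) ^ n / (u + n) ^ w := by
  have h := (hasSum_lerchIntegral (z := 1) (by linarith) hu (.inr ⟨by simp, hw⟩)).summable
  refine (summable_mul_left_iff (Complex.Gamma_ne_zero_of_re_pos (by linarith))).1 h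

/-- Splitting the sum of differences requires each series to converge, hence `Re w > 1` at `z = 1`.
-/
lemma lerchDiffIntegral_eq_Gamma_mul_sub {z w v u : ℂ} (hw : -1 < w.re) (hw0 : w ≠ 0)
    (hv : 0 < v.re) (hu : 0 < u.re) (hz : ‖z‖ < 1 ∨ (z = 1 ∧ 1 < w.re)) :
    lerchDiffIntegral z w v u =
      Complex.Gamma w * (lerchSeries z w v - lerchSeries z w u) := by
  have hs (u : ℂ) (hu : 0 < u.re) : Summable fun n : ℕ => z ^ n / (u + n) ^ w := by
    rcases hz with hz | ⟨rfl, hw1⟩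
    · exact summable_lerchSeries hz hw hu
    · exact summable_lerchSeries_one hw1 hu
  rw [lerchSeries, lerchSeries, ← (hs v hv).tsum_sub (hs u hu), ← tsum_mul_left,
    (hasSum_lerchDiffIntegral hw hw0 hv hu (hz.imp id ?_)).tsum_eq]
  rintro ⟨rfl, h⟩
  exact ⟨by simp, by linarith⟩

/-- Splitting off the term `n = 0` shifts `u` to `u + 1`. This form expresses one series through a
difference, whose integral converges also for `-1 < Re w ≤ 0`. -/
lemma lerchSeries_recurrence {z w u : ℂ} (hw : -1 < w.re) (hu : 0 < u.re) (hz : ‖z‖ < 1) :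
    (1 - z) * lerchSeries z w u =
      1 / u ^ w + z * (lerchSeries z w (u + 1) - lerchSeries z w u) := by
  have h : lerchSeries z w u = 1 / u ^ w + z * lerchSeries z w (u + 1) := by
    rw [lerchSeries, (summable_lerchSeries hz hw hu).tsum_eq_zero_add, lerchSeries,
      ← tsum_mul_left]
    congr 1
    · simp
    · refine tsum_congr fun n => ?_
      push_cast
      rw [show u + (n + 1 : ℂ) = u + 1 + n by ring]
      ring
  linear_combination h

/-- A holomorphic continuation of the Lerch series to the cut plane, for `-1 < Re w`. -/
lemma exists_lerch_continuation {w u : ℂ} (hw : -1 < w.re) (hw0 : w ≠ 0) (hu : 0 < u.re) :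
    ∃ f : ℂ → ℂ, DifferentiableOn ℂ f cutPlane ∧
      ∀ y : ℂ, ‖y‖ < 1 → f y = lerchSeries y w u := by
  have hu1 : 0 < (u + 1).re := by simp; linarith
  have hΓ := Gamma_ne_zero_of_neg_one_lt_re hw hw0
  -- The recurrence solved for the series; `1 - y` has no zero on the cut plane.
  refine ⟨fun y => (1 / u ^ w + y * (lerchDiffIntegral y w (u + 1) u / Complex.Gamma w)) / (1 - y),
    ?_, fun y hy => ?_⟩
  · refine DifferentiableOn.div ((differentiableOn_const _).add (differentiableOn_id.mul
      ((differentiableOn_integral_mul_kernel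
        (integrableOn_cpow_mul_exp_sub_exp hw hu1 hu)).div_const _))) (by fun_prop) fun y hy => ?_
    exact sub_ne_zero.2 (ne_one_of_mem_cutPlane hy).symm
  · have hy1 : 1 - y ≠ 0 :=
      sub_ne_zero.2 (ne_one_of_mem_cutPlane (mem_cutPlane_of_norm_lt_one hy)).symm
    simp only
    rw [lerchDiffIntegral_eq_Gamma_mul_sub hw hw0 hu1 hu (.inl hy), mul_div_cancel_left₀ _ hΓ,
      ← lerchSeries_recurrence hw hu hy, mul_div_cancel_left₀ _ hy1]

lemma Gamma_mul_lerchPhi_sub_of_mem_cutPlane {z w v u : ℂ} (hw : -1 < w.re) (hw0 : w ≠ 0)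
    (hv : 0 < v.re) (hu : 0 < u.re) (hz : z ∈ cutPlane) :
    Complex.Gamma w * (lerchPhi z w v - lerchPhi z w u) = lerchDiffIntegral z w v u := by
  have hΓ := Gamma_ne_zero_of_neg_one_lt_re hw hw0
  obtain ⟨f, hf, hfs⟩ := exists_lerch_continuation hw hw0 hu
  have h1 : IsLerchValue z w u (f z) := .inl ⟨hz, f, hf, hfs, rfl⟩
  have h2 : IsLerchValue z w v (f z + lerchDiffIntegral z w v u / Complex.Gamma w) := by
    refine .inl ⟨hz, fun y => f y + lerchDiffIntegral y w v u / Complex.Gamma w, ?_,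
      fun y hy => ?_, rfl⟩
    · exact hf.add ((differentiableOn_integral_mul_kernel
        (integrableOn_cpow_mul_exp_sub_exp hw hv hu)).div_const _)
    · simp only
      rw [hfs y hy, lerchDiffIntegral_eq_Gamma_mul_sub hw hw0 hv hu (.inl hy),
        mul_div_cancel_left₀ _ hΓ]
      ring
  rw [h1.lerchPhi_eq, h2.lerchPhi_eq]
  field_simp
  ring

/-- The continuation of the Hurwitz zeta function to `0 < Re t`, `t ≠ 1`. -/
lemma isLerchValue_one {t u : ℂ} (ht : 0 < t.re) (ht1 : t ≠ 1) (hu : 0 < u.re) :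
    IsLerchValue 1 t u (riemannZeta t + lerchDiffIntegral 1 t u 1 / Complex.Gamma t) := by
  -- At `u = 1` the series is the Riemann zeta function, whose continuation is known; the difference
  -- integral moves the parameter from `1` to `u`.
  refine .inr ⟨rfl, ht1, 0, ht,
    fun t => riemannZeta t + lerchDiffIntegral 1 t u 1 / Complex.Gamma t, ?_, fun t ht => ?_, rfl⟩
  · rintro t ⟨ht, ht1⟩
    refine DifferentiableAt.differentiableWithinAt ((differentiableAt_riemannZeta ht1).add
      ((differentiableAt_lerchDiffIntegral hasKernelBound_one (by simpa using ht) hu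
        (by simp)).div ?_ (Complex.Gamma_ne_zero_of_re_pos ht)))
    refine Complex.differentiableAt_Gamma _ fun n hn => ?_
    rw [hn] at ht
    simp at ht
    linarith [(n.cast_nonneg : (0 : ℝ) ≤ n)]
  · have ht0 : 0 < t.re := by linarith
    simp only
    rw [lerchDiffIntegral_eq_Gamma_mul_sub (by linarith) (ne_zero_of_re_pos ht0) hu (by simp)
      (.inr ⟨rfl, ht⟩), mul_div_cancel_left₀ _ (Complex.Gamma_ne_zero_of_re_pos ht0),
      zeta_eq_tsum_one_div_nat_add_one_cpow ht]
    have : lerchSeries 1 t 1 = ∑' n : ℕ, 1 / ((n : ℂ) + 1) ^ t := by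
      simp [lerchSeries, add_comm]
    rw [this]
    ring

/-- The auxiliary parameter `1` cancels term by term in the series expansions. -/
lemma lerchDiffIntegral_one_sub {w v u : ℂ} (hw : 0 < w.re) (hv : 0 < v.re) (hu : 0 < u.re) :
    lerchDiffIntegral 1 w v 1 - lerchDiffIntegral 1 w u 1 = lerchDiffIntegral 1 w v u := by
  have h (v u : ℂ) (hv : 0 < v.re) (hu : 0 < u.re) := hasSum_lerchDiffIntegral (z := 1)
    (by linarith) (ne_zero_of_re_pos hw) hv hu (.inr ⟨by simp, hw⟩)
  refine ((h v 1 hv (by simp)).sub (h u 1 hu (by simp))).unique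
    ((h v u hv hu).congr_fun fun n => ?_)
  ring

lemma Gamma_mul_lerchPhi_sub_one {w v u : ℂ} (hw : 0 < w.re) (hw1 : w ≠ 1)
    (hv : 0 < v.re) (hu : 0 < u.re) :
    Complex.Gamma w * (lerchPhi 1 w v - lerchPhi 1 w u) = lerchDiffIntegral 1 w v u := by
  have hΓ := Complex.Gamma_ne_zero_of_re_pos hw
  rw [(isLerchValue_one hw hw1 hu).lerchPhi_eq, (isLerchValue_one hw hw1 hv).lerchPhi_eq,
    ← lerchDiffIntegral_one_sub hw hv hu]
  field_simp
  ring

lemma IsLerchValue.eq_lerchSeries {w u y : ℂ} (h : IsLerchValue 1 w u y) (hw : 1 < w.re) :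
    y = lerchSeries 1 w u := by
  rcases h with ⟨h, -⟩ | ⟨-, -, -, -, f, -, hf, rfl⟩
  · exact absurd rfl (ne_one_of_mem_cutPlane h)
  · exact hf w hw

/-- The integral representation of the Lerch transcendent. -/
lemma Gamma_mul_lerchPhi {z w u : ℂ} (hw : 0 < w.re) (hu : 0 < u.re)
    (hz : z ∈ cutPlane ∨ (z = 1 ∧ 1 < w.re)) :
    Complex.Gamma w * lerchPhi z w u = lerchIntegral z w u := by
  have hΓ := Complex.Gamma_ne_zero_of_re_pos hw
  rcases hz with hz | ⟨rfl, hw1⟩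
  · have : IsLerchValue z w u (lerchIntegral z w u / Complex.Gamma w) := by
      refine .inl ⟨hz, fun y => lerchIntegral y w u / Complex.Gamma w, ?_, fun y hy => ?_, rfl⟩
      · exact (differentiableOn_integral_mul_kernel
          (integrableOn_cpow_mul_exp (by simpa using hw) hu)).div_const _
      · simp only
        rw [lerchIntegral_eq_Gamma_mul_lerchSeries hw hu (.inl hy), mul_div_cancel_left₀ _ hΓ]
    rw [this.lerchPhi_eq, mul_div_cancel₀ _ hΓ]
  · have h := isLerchValue_one hw (by rintro rfl; simp at hw1) hu
    rw [h.lerchPhi_eq, h.eq_lerchSeries hw1,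
      lerchIntegral_eq_Gamma_mul_lerchSeries hw hu (.inr ⟨by simp, hw1⟩)]

/-! ### Evaluation of the cube integrals -/

lemma ae_cubeUniform_pos (ι : Type*) [Fintype ι] :
    ∀ᵐ x ∂cubeUniform ι, ∀ i, 0 < x i := by
  have e : cubeUniform ι = (volume : Measure (ι → ℝ)).restrict (univ.pi fun _ => Ioc 0 1) := by
    rw [volume_pi, Measure.restrict_pi_pi, cubeUniform, unitUniform, restrict_Ioc_eq_restrict_Icc]
  rw [e]
  filter_upwards [ae_restrict_mem (MeasurableSet.univ_pi fun _ => measurableSet_Ioc)] with x hx i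
  exact (hx i (mem_univ i)).1

lemma log_prod_eq_neg_sum {ι : Type*} {x : ι → ℝ} (hx : ∀ i, 0 < x i) (t : Finset ι) :
    Real.log (∏ i ∈ t, x i) = -∑ i ∈ t, -Real.log (x i) := by
  rw [Real.log_prod fun i _ => (hx i).ne', Finset.sum_neg_distrib, neg_neg]

lemma prod_eq_exp {ι : Type*} {x : ι → ℝ} (hx : ∀ i, 0 < x i) (t : Finset ι) :
    ∏ i ∈ t, x i = Real.exp (-∑ i ∈ t, -Real.log (x i)) := by
  rw [← log_prod_eq_neg_sum hx, Real.exp_log (Finset.prod_pos fun i _ => hx i)]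

lemma prod_cpow_eq_exp {ι : Type*} {x : ι → ℝ} (hx : ∀ i, 0 < x i) (t : Finset ι) (c : ℂ) :
    ((∏ i ∈ t, x i : ℝ) : ℂ) ^ c = Complex.exp (-c * (∑ i ∈ t, -Real.log (x i) : ℝ)) := by
  have hp : 0 < ∏ i ∈ t, x i := Finset.prod_pos fun i _ => hx i
  rw [Complex.cpow_def_of_ne_zero (by exact_mod_cast hp.ne'), ← Complex.ofReal_log hp.le,
    log_prod_eq_neg_sum hx]
  push_cast
  ring_nf

lemma cubeIntegrand_eq {m : ℕ} {x : Fin m → ℝ} (hx : ∀ i, 0 < x i) (z s : ℂ)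
    (N : (Fin m → ℝ) → ℂ) :
    cubeIntegrand m z s N x = N x * ((negLogSum x : ℂ) ^ s * kernel z (negLogSum x)) := by
  rw [cubeIntegrand, log_prod_eq_neg_sum hx, prod_eq_exp hx, kernel, negLogSum]
  push_cast
  rw [neg_neg]
  ring

lemma natPow_mul_exp_mul {n : ℕ} {y : ℝ} (hy : 0 < y) (u s : ℂ) :
    ((y ^ n / n.factorial * Real.exp (-y) : ℝ) : ℂ) *
        (Complex.exp (-(u - 1) * y) * (y : ℂ) ^ s) =
      1 / n.factorial * ((y : ℂ) ^ (s + n + 1 - 1) * Complex.exp (-u * y)) := by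
  have hy0 : (y : ℂ) ≠ 0 := by exact_mod_cast hy.ne'
  rw [add_sub_cancel_right, Complex.cpow_add _ _ hy0, Complex.cpow_natCast,
    show -u * (y : ℂ) = -(u - 1) * y + -y by ring, Complex.exp_add]
  push_cast
  ring

/-- The integral over the cube whose numerator is a power of `x₁ ⋯ xₘ`. -/
lemma integral_cube_power {m n : ℕ} (hm : m = n + 1) {z s u : ℂ} {κ : ℝ} (hz : HasKernelBound z κ)
    (hs : κ < (s + n + 1).re) (hu : 0 < u.re) :
    IntegrableOn (cubeIntegrand m z s (fun x => ((∏ i, x i : ℝ) : ℂ) ^ (u - 1)))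
        (Icc (0 : Fin m → ℝ) 1) ∧
      ∫ x in Icc (0 : Fin m → ℝ) 1,
          cubeIntegrand m z s (fun x => ((∏ i, x i : ℝ) : ℂ) ^ (u - 1)) x =
        1 / n.factorial * lerchIntegral z (s + n + 1) u := by
  rw [IntegrableOn, volume_restrict_Icc_cube]
  have hmeas : Measurable fun y : ℝ => Complex.exp (-(u - 1) * y) * ((y : ℂ) ^ s * kernel z y) :=
    Measurable.mul (by fun_prop) (Measurable.mul (by fun_prop) (measurable_kernel z))
  -- The Erlang density supplies `e^{-y}`, turning `u - 1` into `u`, and `y^n`, raising the exponent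
  -- `s` by `n`.
  have hB : EqOn (fun y : ℝ => ((y ^ n / n.factorial * Real.exp (-y) : ℝ) : ℂ) *
        (Complex.exp (-(u - 1) * y) * ((y : ℂ) ^ s * kernel z y)))
      (fun y : ℝ => 1 / n.factorial *
        ((y : ℂ) ^ (s + n + 1 - 1) * Complex.exp (-u * y) * kernel z y)) (Ioi 0) := fun y hy => by
    simp only
    rw [← mul_assoc (1 / (n.factorial : ℂ)), ← natPow_mul_exp_mul hy]
    ring
  obtain ⟨h1, h2⟩ := integral_cube_comp_negLogSum hm hmeas
    (IntegrableOn.congr_fun ((integrableOn_lerchIntegral hz hs hu).const_mul _) hB.symm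
      measurableSet_Ioi)
  have hae : (fun x : Fin m → ℝ => Complex.exp (-(u - 1) * negLogSum x) *
      ((negLogSum x : ℂ) ^ s * kernel z (negLogSum x))) =ᵐ[cubeUniform (Fin m)]
      cubeIntegrand m z s (fun x => ((∏ i, x i : ℝ) : ℂ) ^ (u - 1)) := by
    filter_upwards [ae_cubeUniform_pos (Fin m)] with x hx
    rw [cubeIntegrand_eq hx, prod_cpow_eq_exp hx]
    rfl
  refine ⟨h1.congr hae, ?_⟩
  rw [← integral_congr_ae hae, h2, setIntegral_congr_fun measurableSet_Ioi hB, integral_const_mul,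
    lerchIntegral]

/-- The exponent is `-u q - v (y - q)` with `q` and `y - q` both positive. -/
lemma norm_cpow_mul_exp_mul_exp_le {w u v : ℂ} {q y : ℝ} (hq : 0 < q) (hqy : q < y) :
    ‖(y : ℂ) ^ w * Complex.exp (-v * y) * Complex.exp (-(u - v) * q)‖ ≤
      y ^ w.re * Real.exp (-(min u.re v.re * y)) := by
  have hy : 0 < y := hq.trans hqy
  rw [mul_assoc, ← Complex.exp_add, norm_mul, Complex.norm_cpow_eq_rpow_re_of_pos hy,
    Complex.norm_exp]
  gcongr
  simp only [Complex.add_re, Complex.mul_re, Complex.neg_re, Complex.sub_re, Complex.ofReal_re,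
    Complex.ofReal_im, mul_zero, sub_zero]
  have h1 := mul_le_mul_of_nonneg_right (min_le_left u.re v.re) hq.le
  have h2 := mul_le_mul_of_nonneg_right (min_le_right u.re v.re) (sub_pos.2 hqy).le
  linarith

lemma integral_exp_neg_mul {c : ℂ} (hc : c ≠ 0) (y : ℝ) :
    ∫ q in (0 : ℝ)..y, Complex.exp (-c * q) = (1 - Complex.exp (-c * y)) / c := by
  rw [integral_exp_mul_complex (neg_ne_zero.2 hc)]
  simp only [Complex.ofReal_zero, mul_zero, Complex.exp_zero]
  field_simp
  ring

/-- The integral over the cube with numerator `cubeF`. -/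
lemma integral_cube_cubeF {m n : ℕ} (hm : m = n + 2) {z s u v : ℂ} {κ : ℝ}
    (hz : HasKernelBound z κ) (hs : κ - 1 < (s + n + 1).re) (hu : 0 < u.re) (hv : 0 < v.re)
    (huv : u ≠ v) :
    IntegrableOn (cubeIntegrand m z s (cubeF m u v)) (Icc (0 : Fin m → ℝ) 1) ∧
      ∫ x in Icc (0 : Fin m → ℝ) 1, cubeIntegrand m z s (cubeF m u v) x =
        1 / n.factorial * (lerchDiffIntegral z (s + n + 1) v u / (u - v)) := by
  rw [IntegrableOn, volume_restrict_Icc_cube]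
  have hc : u - v ≠ 0 := sub_ne_zero.2 huv
  have hδ : 0 < min u.re v.re := lt_min hu hv
  set w := s + n + 1 with hw
  set B : ℝ → ℂ := fun y => 1 / n.factorial *
    ((y : ℂ) ^ (w - 1) * Complex.exp (-v * y) * kernel z y) with hBdef
  set H : ℝ × ℝ → ℂ := fun p => Complex.exp (-(v - 1) * p.2) *
    ((p.2 : ℂ) ^ s * kernel z p.2) * Complex.exp (-(u - v) * p.1) with hHdef
  have hBm : Measurable B :=
    ((measurable_cpow_mul_exp _ v).mul (measurable_kernel z)).const_mul _
  have hHm : Measurable H :=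
    (Measurable.mul (by fun_prop) (Measurable.mul (by fun_prop)
      ((measurable_kernel z).comp measurable_snd))).mul (by fun_prop)
  have hHB : EqOn (fun p : ℝ × ℝ => B p.2 * Complex.exp (-(u - v) * p.1))
      (fun p => ((p.2 ^ n / n.factorial * Real.exp (-p.2) : ℝ) : ℂ) * H p) wedge := by
    rintro ⟨q, y⟩ ⟨hq, hqy⟩
    simp only [hBdef, hHdef, hw]
    rw [← mul_assoc (1 / (n.factorial : ℂ)), ← natPow_mul_exp_mul (hq.trans hqy)]
    ring
  set b : ℝ → ℝ := fun y => 1 / n.factorial *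
    (y ^ (w - 1).re * Real.exp (-(min u.re v.re * y)) * ‖kernel z y‖) with hb
  -- The extra factor `y` from the slice length is why `Re (s + n + 1) > κ - 1` is enough.
  have hb1 : IntegrableOn (fun y => y * b y) (Ioi 0) := by
    have := (integrableOn_rpow_mul_exp_mul_kernel (r := w.re) hz hs hδ).const_mul
      (1 / (n.factorial : ℝ))
    refine IntegrableOn.congr_fun this (fun y hy => ?_) measurableSet_Ioi
    have hy : 0 < y := hy
    have e : y ^ w.re = y ^ (w - 1).re * y := by
      rw [← Real.rpow_add_one hy.ne']; simp
    simp only [hb, e]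
    ring
  have hb2 : ∀ q y : ℝ, 0 < q → q < y → ‖B y * Complex.exp (-(u - v) * q)‖ ≤ b y := by
    intro q y hq hqy
    have := norm_cpow_mul_exp_mul_exp_le (w := w - 1) (u := u) (v := v) hq hqy
    rw [show B y * Complex.exp (-(u - v) * q) = 1 / n.factorial * ((y : ℂ) ^ (w - 1) *
      Complex.exp (-v * y) * Complex.exp (-(u - v) * q) * kernel z y) by simp only [hBdef]; ring,
      norm_mul, norm_mul _ (kernel z y), norm_div, norm_one, Complex.norm_natCast]
    simp only [hb]
    gcongr
  obtain ⟨hint, hval⟩ := integral_wedge_mul_exp hBm hb1 hb2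
  obtain ⟨h1, h2⟩ := integral_cube_sum_comp hm hHm (hint.congr_fun hHB measurableSet_wedge)
  have hae : (fun x : Fin m → ℝ =>
      ∑ k ∈ Finset.univ.filter (fun k : Fin m => (k : ℕ) + 1 < m),
        H (∑ i ∈ Finset.Iic k, -Real.log (x i), negLogSum x)) =ᵐ[cubeUniform (Fin m)]
      cubeIntegrand m z s (cubeF m u v) := by
    filter_upwards [ae_cubeUniform_pos (Fin m)] with x hx
    rw [cubeIntegrand_eq hx, cubeF, prod_cpow_eq_exp hx,
      Finset.sum_congr rfl fun k _ => prod_cpow_eq_exp hx (Finset.Iic k) (u - v)]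
    simp only [hHdef]
    rw [← Finset.mul_sum, ← negLogSum]
    ring
  refine ⟨h1.congr hae, ?_⟩
  rw [← integral_congr_ae hae, h2, ← setIntegral_congr_fun measurableSet_wedge hHB, hval,
    lerchDiffIntegral, ← integral_div, ← integral_const_mul]
  refine setIntegral_congr_fun measurableSet_Ioi fun y _ => ?_
  simp only [hBdef]
  rw [integral_exp_neg_mul hc, show -u * (y : ℂ) = -v * y + -(u - v) * y by ring, Complex.exp_add]
  ring

lemma Gamma_mul_lerchPhi_sub {z w v u : ℂ} (hv : 0 < v.re) (hu : 0 < u.re)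
    (h : (z ∈ cutPlane ∧ -1 < w.re ∧ w ≠ 0) ∨ (z = 1 ∧ 0 < w.re ∧ w ≠ 1)) :
    Complex.Gamma w * (lerchPhi z w v - lerchPhi z w u) = lerchDiffIntegral z w v u := by
  rcases h with ⟨hz, hw, hw0⟩ | ⟨rfl, hw, hw1⟩
  · exact Gamma_mul_lerchPhi_sub_of_mem_cutPlane hw hw0 hv hu hz
  · exact Gamma_mul_lerchPhi_sub_one hw hw1 hv hu

theorem theorem3 (m : ℕ) (hm : 1 ≤ m) (u z s : ℂ) (hu : 0 < u.re)
    (hzs : (z ∈ cutPlane ∧ -(m : ℝ) < s.re) ∨ (z = 1 ∧ 1 - (m : ℝ) < s.re)) :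
    -- the first family, for `m > 1`, `Re v > 0`, `u ≠ v`
    (∀ v : ℂ, 0 < v.re → u ≠ v → 1 < m →
      MeasureTheory.IntegrableOn (cubeIntegrand m z s (cubeF m u v))
        (Set.Icc (0 : Fin m → ℝ) 1) ∧
      -- away from the removable singularities of the right-hand side
      ((z ≠ 1 → s ≠ 1 - (m : ℂ)) → (z = 1 → s ≠ 2 - (m : ℂ)) →
        ∫ x in Set.Icc (0 : Fin m → ℝ) 1, cubeIntegrand m z s (cubeF m u v) x =
          Complex.Gamma (s + m - 1) / (Nat.factorial (m - 2) : ℂ) *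
            ((lerchPhi z (s + m - 1) v - lerchPhi z (s + m - 1) u) / (u - v))) ∧
      -- at such a singularity the right-hand side is its limit
      ((z ≠ 1 ∧ s = 1 - (m : ℂ)) ∨ (z = 1 ∧ s = 2 - (m : ℂ)) →
        Filter.Tendsto
          (fun t : ℂ => Complex.Gamma (t + m - 1) / (Nat.factorial (m - 2) : ℂ) *
            ((lerchPhi z (t + m - 1) v - lerchPhi z (t + m - 1) u) / (u - v)))
          (nhdsWithin s {s}ᶜ)
          (nhds (∫ x in Set.Icc (0 : Fin m → ℝ) 1, cubeIntegrand m z s (cubeF m u v) x)))) ∧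
    -- the second family, for `m ≥ 1`
    (MeasureTheory.IntegrableOn
        (cubeIntegrand m z s (fun x => ((∏ i, x i : ℝ) : ℂ) ^ (u - 1)))
        (Set.Icc (0 : Fin m → ℝ) 1) ∧
      ∫ x in Set.Icc (0 : Fin m → ℝ) 1,
          cubeIntegrand m z s (fun x => ((∏ i, x i : ℝ) : ℂ) ^ (u - 1)) x =
        Complex.Gamma (s + m) / (Nat.factorial (m - 1) : ℂ) * lerchPhi z (s + m) u) := by
  -- Both cases of the hypothesis become one inequality, with `κ = 0` on the cut plane and `κ = 1`
  -- at `z = 1`.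
  obtain ⟨κ, hκ, hκs⟩ : ∃ κ, HasKernelBound z κ ∧ κ < s.re + m := by
    rcases hzs with ⟨hz, hs⟩ | ⟨rfl, hs⟩
    · exact ⟨0, hasKernelBound_of_mem_cutPlane hz, by linarith⟩
    · exact ⟨1, hasKernelBound_one, by linarith⟩
  constructor
  · intro v hv huv hm1
    obtain ⟨n, rfl⟩ : ∃ n, m = n + 2 := ⟨m - 2, by omega⟩
    have hshift (t : ℂ) : t + (n + 2 : ℕ) - 1 = t + n + 1 := by push_cast; ring
    have hre (t : ℂ) : (t + n + 1).re = t.re + n + 1 := by simp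
    push_cast at hκs hzs
    obtain ⟨hint, hval⟩ := integral_cube_cubeF rfl hκ (by rw [hre]; linarith) hu hv huv
    have hfun (t : ℂ) (h : (z ∈ cutPlane ∧ -1 < (t + n + 1).re ∧ t + n + 1 ≠ 0) ∨
        (z = 1 ∧ 0 < (t + n + 1).re ∧ t + n + 1 ≠ 1)) :
        Complex.Gamma (t + n + 1) / (n.factorial : ℂ) *
          ((lerchPhi z (t + n + 1) v - lerchPhi z (t + n + 1) u) / (u - v)) =
        1 / n.factorial * (lerchDiffIntegral z (t + n + 1) v u / (u - v)) := by
      rw [← Gamma_mul_lerchPhi_sub hv hu h]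
      ring
    simp only [hshift, Nat.add_sub_cancel]
    refine ⟨hint, fun h0 h1 => ?_, fun hsing => ?_⟩
    · rw [hval, hfun s]
      rcases hzs with ⟨hz, hs⟩ | ⟨rfl, hs⟩
      · refine .inl ⟨hz, by rw [hre]; linarith, fun h => h0 (ne_one_of_mem_cutPlane hz) ?_⟩
        push_cast
        linear_combination h
      · refine .inr ⟨rfl, by rw [hre]; linarith, fun h => h1 rfl ?_⟩
        push_cast
        linear_combination h
    · rw [hval]
      -- The integral side is continuous at the singular point itself and equals the Gamma–Lerch
      -- expression on a punctured neighbourhood.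
      have hcont : ContinuousAt (fun t : ℂ => 1 / (n.factorial : ℂ) *
          (lerchDiffIntegral z (t + n + 1) v u / (u - v))) s := by
        refine continuousAt_const.mul (ContinuousAt.div_const ?_ _)
        exact ContinuousAt.comp (f := fun t : ℂ => t + n + 1)
          (differentiableAt_lerchDiffIntegral hκ (by rw [hre]; linarith) hv hu).continuousAt
          (by fun_prop)
      refine (hcont.tendsto.mono_left nhdsWithin_le_nhds).congr' ?_
      -- At the singular point the exponent is `0` (cut plane) or `1` (`z = 1`), so a margin of one
      -- unit keeps its real part above `-1` or `0`.
      have hnear : ∀ᶠ t in nhdsWithin s {s}ᶜ, s.re - 1 < t.re :=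
        nhdsWithin_le_nhds ((isOpen_lt continuous_const Complex.continuous_re).mem_nhds
          (by simp))
      filter_upwards [self_mem_nhdsWithin, hnear] with t hts ht
      have hts : t ≠ s := hts
      refine (hfun t ?_).symm
      rcases hsing with ⟨hz, rfl⟩ | ⟨rfl, rfl⟩
      · have hz' : z ∈ cutPlane := hzs.elim And.left fun h => absurd h.1 hz
        refine .inl ⟨hz', ?_, fun h => hts ?_⟩
        · rw [hre]; simp at ht; linarith
        · push_cast
          linear_combination h
      · refine .inr ⟨rfl, ?_, fun h => hts ?_⟩
        · rw [hre]; simp at ht; linarith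
        · push_cast
          linear_combination h
  · obtain ⟨n, rfl⟩ : ∃ n, m = n + 1 := ⟨m - 1, by omega⟩
    have hshift : s + (n + 1 : ℕ) = s + n + 1 := by push_cast; ring
    have hre : (s + n + 1).re = s.re + n + 1 := by simp
    push_cast at hκs hzs
    obtain ⟨hint, hval⟩ := integral_cube_power rfl hκ (by rw [hre]; linarith) hu
    refine ⟨hint, ?_⟩
    rw [hval, hshift, Nat.add_sub_cancel, ← Gamma_mul_lerchPhi ?_ hu ?_]
    · ring
    · rw [hre]
      rcases hzs with ⟨-, hs⟩ | ⟨-, hs⟩ <;> linarith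
    · refine hzs.imp And.left fun h => ⟨h.1, ?_⟩
      rw [hre]
      linarith [h.2]
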